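/- Let $(M^n,g)$ be a Hermitian manifold, that is, a complex manifold of complex dimension $n$, with complex structure $J$, and a smooth $J$-invariant Riemannian metric $g$ (no compactness is assumed). Let $\nabla^c$ be the Chern connection (the unique connection with $\nabla^c g=0$, $\nabla^c J=0$ whose torsion is of type $(2,0)$), let $\nabla^s$ be the Strominger (Bismut) connection (the unique connection with $\nabla^s g=0$, $\nabla^s J=0$ whose torsion is totally skew-symmetric), and let $D^0=\frac12(\nabla^c+\nabla^s)$ be the Lichnerowicz connection. Suppose that $D^0$ is Kähler-like, i.e. its curvature tensor $R(x,y,z,w)=g(R(x,y)z,w)$ satisfies $$R(x,y,z,w)+R(y,z,x,w)+R(z,x,y,w)=0,\qquad R(Jx,Jy,z,w)=R(x,y,z,w)=R(x,y,Jz,Jw)$$ for all real tangent vectors $x,y,z,w$. Let $\eta$ be Gauduchon's torsion $1$-form: if $e$ is a local frame of $(1,0)$-vectors with dual coframe $\varphi$ and the torsion of $\nabla^c$ is $T(e_i,e_j)=2\sum_k T^k_{ij}e_k$, then $\eta=\sum_k\eta_k\varphi_k$ with $\eta_k=\sum_i T^i_{ik}$. Then $\eta=0$ everywhere on $M$; in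 other words $g$ is balanced, i.e. its Kähler form $\omega=g(J\cdot,\cdot)$ satisfies $d(\omega^{n-1})=0$. -/

import Mathlib

open Bundle
open scoped Manifold ContDiff

noncomputable section

namespace HermitianGeometry

/-- A complex manifold is in particular a real manifold of the same regularity. -/
instance realManifold {E : Type*} [NormedAddCommGroup E] [NormedSpace ℂ E]
    {M : Type*} [TopologicalSpace M] [ChartedSpace E M] {k : ℕ∞ω} [IsManifold 𝓘(ℂ, E) k M] :
    IsManifold 𝓘(ℝ, E) k M := by
  refine isManifold_of_contDiffOn 𝓘(ℝ, E) k M fun e e' he he' => ?_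
  have h := (contDiffGroupoid k 𝓘(ℂ, E)).compatible he he'
  rw [contDiffGroupoid, mem_groupoid_of_pregroupoid] at h
  have h1 : ContDiffOn ℂ k _ _ := h.1
  exact h1.restrict_scalars ℝ

section Definitions

variable {E : Type*} [NormedAddCommGroup E] [NormedSpace ℂ E]
  {M : Type*} [TopologicalSpace M] [ChartedSpace E M] [IsManifold 𝓘(ℂ, E) ω M]

variable (E M) in
/-- (Not necessarily continuous) real vector fields on `M`. -/
abbrev VField : Type _ := (x : M) → TangentSpace 𝓘(ℝ, E) x

/-- The almost complex structure `J` of the complex manifold `M` at `x`: multiplication by `i` on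
the tangent space `T_x M`, which is the complex vector space `E` seen through the preferred
holomorphic chart at `x`. -/
def complexStructure (x : M) : TangentSpace 𝓘(ℝ, E) x →L[ℝ] TangentSpace 𝓘(ℝ, E) x :=
  ((Complex.I • ContinuousLinearMap.id ℂ E).restrictScalars ℝ : E →L[ℝ] E)

/-- `J` applied to a vector field. -/
def complexStructureField (X : VField E M) : VField E M := fun x => complexStructure x (X x)

/-- The vector field `X` is differentiable at `x`. -/
def DiffAt (X : VField E M) (x : M) : Prop :=
  MDifferentiableAt 𝓘(ℝ, E) (𝓘(ℝ, E).prod 𝓘(ℝ, E))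
    (fun y => (⟨y, X y⟩ : TotalSpace E (TangentSpace 𝓘(ℝ, E) : M → Type _))) x

/-- The vector field `X` is smooth. -/
def IsSmoothField (X : VField E M) : Prop :=
  ContMDiff 𝓘(ℝ, E) (𝓘(ℝ, E).prod 𝓘(ℝ, E)) ∞
    (fun y => (⟨y, X y⟩ : TotalSpace E (TangentSpace 𝓘(ℝ, E) : M → Type _)))

variable (E M) in
/-- A Hermitian metric on a complex manifold: a smooth `J`-invariant Riemannian metric. -/
structure HermitianMetric extends
    ContMDiffRiemannianMetric 𝓘(ℝ, E) ∞ E (fun x : M => TangentSpace 𝓘(ℝ, E) x) where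
  invariant : ∀ (x : M) (u v : TangentSpace 𝓘(ℝ, E) x),
    inner x (complexStructure x u) (complexStructure x v) = inner x u v

variable (E M) in
/-- Affine connections on the real tangent bundle. In Mathlib's convention `D Y x (X x)` is the
value at `x` of the covariant derivative of `Y` in the direction `X`. -/
abbrev Connection : Type _ := CovariantDerivative 𝓘(ℝ, E) E (TangentSpace 𝓘(ℝ, E) : M → Type _)

/-- `D g = 0`. -/
def IsMetric (g : HermitianMetric E M) (D : Connection E M) : Prop :=
  ∀ (x : M) (Y Z : VField E M), DiffAt Y x → DiffAt Z x → ∀ v : TangentSpace 𝓘(ℝ, E) x,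
    (mfderiv 𝓘(ℝ, E) 𝓘(ℝ, ℝ) (fun y => g.inner y (Y y) (Z y)) x v : ℝ) =
      g.inner x (D Y x v) (Z x) + g.inner x (Y x) (D Z x v)

/-- `D J = 0`. -/
def IsComplex (D : Connection E M) : Prop :=
  ∀ (x : M) (Y : VField E M), DiffAt Y x → ∀ v : TangentSpace 𝓘(ℝ, E) x,
    D (complexStructureField Y) x v = complexStructure x (D Y x v)

/-- A Hermitian connection: a smooth connection with `D g = 0` and `D J = 0`. -/
structure IsHermitianConnection (g : HermitianMetric E M) (D : Connection E M) : Prop where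
  smooth : CovariantDerivative.ContMDiffCovariantDerivative D ∞
  metric : IsMetric g D
  complex : IsComplex D

section Torsion

variable [FiniteDimensional ℂ E]

local instance completeSpaceModel : CompleteSpace E := FiniteDimensional.complete ℂ E

/-- The torsion tensor `T(u, v)`, characterized by `T(X, Y) = D_X Y - D_Y X - [X, Y]`. -/
def torsion (D : Connection E M) (x : M) (u v : TangentSpace 𝓘(ℝ, E) x) :
    TangentSpace 𝓘(ℝ, E) x :=
  CovariantDerivative.torsion D x u v

/-- The Chern connection: the unique Hermitian connection whose torsion is of type `(2,0)`,
that is, whose torsion is complex linear in its (first, hence by skew-symmetry each) argument. -/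
structure IsChernConnection (g : HermitianMetric E M) (D : Connection E M) : Prop
    extends IsHermitianConnection g D where
  torsion_type : ∀ (x : M) (u v : TangentSpace 𝓘(ℝ, E) x),
    torsion D x (complexStructure x u) v = complexStructure x (torsion D x u v)

/-- The Strominger (Bismut) connection: the unique Hermitian connection whose torsion, lowered
with the metric to a trilinear form, is totally skew-symmetric. -/
structure IsStromingerConnection (g : HermitianMetric E M) (D : Connection E M) : Prop
    extends IsHermitianConnection g D where
  torsion_skew : ∀ (x : M) (u v w : TangentSpace 𝓘(ℝ, E) x),
    g.inner x (torsion D x u v) w = - g.inner x (torsion D x u w) v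

/-- The trace over `ℂ` of an endomorphism `A` of `T_x M` commuting with `J`, in terms of
real traces: `tr_ℂ A = (tr_ℝ A - i tr_ℝ (J A)) / 2`. -/
def complexTrace (x : M) (A : TangentSpace 𝓘(ℝ, E) x →ₗ[ℝ] TangentSpace 𝓘(ℝ, E) x) : ℂ :=
  ((LinearMap.trace ℝ (TangentSpace 𝓘(ℝ, E) x) A : ℝ) -
    Complex.I * (LinearMap.trace ℝ (TangentSpace 𝓘(ℝ, E) x)
      ((complexStructure x).toLinearMap ∘ₗ A) : ℝ)) / 2

/-- Gauduchon's torsion `1`-form `η` of the Chern connection `D`. In a local frame `e` of type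
`(1,0)` with dual coframe `φ` the torsion is `T(e_i, e_j) = ∑_k 2 T^k_{ij} e_k`, that is
`τ_k = ∑_{i,j} T^k_{ij} φ_i ∧ φ_j`, and `η = ∑_k η_k φ_k` with `η_k = ∑_i T^i_{ik}`. Hence
`η(v) = tr_ℂ (u ↦ T(u, v)) / 2`; as `η` is of type `(1,0)`, it is determined by its values on
real tangent vectors `v`. -/
def torsionOneForm (D : Connection E M) (x : M) (v : TangentSpace 𝓘(ℝ, E) x) : ℂ :=
  complexTrace x
    { toFun := fun u => torsion D x u v
      map_add' := fun a b => by simp [torsion]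
      map_smul' := fun c a => by simp [torsion] } / 2

end Torsion

/-- The Gauduchon connection `D^r = (1 + r)/2 ∇^c + (1 - r)/2 ∇^s`, for `∇^c` the Chern and `∇^s`
the Strominger connection. -/
def gauduchonConnection (r : ℝ) (chern strominger : Connection E M) : Connection E M :=
  CovariantDerivative.affineCombination chern strominger (fun _ => (1 + r) / 2)

/-- The Lichnerowicz connection `D^0`. -/
def lichnerowiczConnection (chern strominger : Connection E M) : Connection E M :=
  gauduchonConnection 0 chern strominger

/-- The curvature `R(X, Y) Z = D_X D_Y Z - D_Y D_X Z - D_[X, Y] Z`. -/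
def curvature (D : Connection E M) (X Y Z : VField E M) : VField E M := fun x =>
  D (fun y => D Z y (Y y)) x (X x) - D (fun y => D Z y (X y)) x (Y x)
    - D Z x (VectorField.mlieBracket 𝓘(ℝ, E) X Y x)

/-- The function `R(X, Y, Z, W) = g(R(X, Y) Z, W)`. -/
def curvature₄ (g : HermitianMetric E M) (D : Connection E M)
    (X Y Z W : VField E M) (x : M) : ℝ :=
  g.inner x (curvature D X Y Z x) (W x)

/-- The connection `D` is Kähler-like: its curvature satisfies the first Bianchi identity
`R(x, y, z, w) + R(y, z, x, w) + R(z, x, y, w) = 0` and the type condition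
`R(Jx, Jy, z, w) = R(x, y, z, w) = R(x, y, Jz, Jw)`. (On a Hausdorff manifold each tangent vector
is the value of a smooth vector field, and `R` is a tensor.) -/
structure IsKahlerLike (g : HermitianMetric E M) (D : Connection E M) : Prop where
  bianchi : ∀ X Y Z W : VField E M, IsSmoothField X → IsSmoothField Y → IsSmoothField Z →
    IsSmoothField W → ∀ x : M,
      curvature₄ g D X Y Z W x + curvature₄ g D Y Z X W x + curvature₄ g D Z X Y W x = 0
  type_left : ∀ X Y Z W : VField E M, IsSmoothField X → IsSmoothField Y → IsSmoothField Z →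
    IsSmoothField W → ∀ x : M,
      curvature₄ g D (complexStructureField X) (complexStructureField Y) Z W x =
        curvature₄ g D X Y Z W x
  type_right : ∀ X Y Z W : VField E M, IsSmoothField X → IsSmoothField Y → IsSmoothField Z →
    IsSmoothField W → ∀ x : M,
      curvature₄ g D X Y (complexStructureField Z) (complexStructureField W) x =
        curvature₄ g D X Y Z W x

section Balanced

/-- The Kähler form `ω(u, v) = g(J u, v)`. -/
def kahlerForm (g : HermitianMetric E M) (x : M) (u v : TangentSpace 𝓘(ℝ, E) x) : ℝ :=
  g.inner x (complexStructure x u) v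

/-- The `m`-fold tensor power of the Kähler form, with arguments indexed by pairs `(j, c)`. -/
def kahlerTensorPower (g : HermitianMetric E M) (m : ℕ) (x : M) :
    MultilinearMap ℝ (fun _ : Fin m × Fin 2 => TangentSpace 𝓘(ℝ, E) x) ℝ where
  toFun v := ∏ j : Fin m, kahlerForm g x (v (j, 0)) (v (j, 1))
  map_update_add' := by
    intro inst v p a b
    obtain rfl : inst = instDecidableEqProd := Subsingleton.elim _ _
    obtain ⟨k, c⟩ := p
    simp only [← Finset.mul_prod_erase Finset.univ _ (Finset.mem_univ k)]
    have hrest : ∀ a : TangentSpace 𝓘(ℝ, E) x, (∏ j ∈ Finset.univ.erase k,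
        kahlerForm g x (Function.update v (k, c) a (j, 0)) (Function.update v (k, c) a (j, 1))) =
        ∏ j ∈ Finset.univ.erase k, kahlerForm g x (v (j, 0)) (v (j, 1)) := by
      intro a
      refine Finset.prod_congr rfl fun j hj => ?_
      have hne : j ≠ k := Finset.ne_of_mem_erase hj
      simp [hne]
    rw [hrest, hrest, hrest, ← add_mul]
    congr 1
    fin_cases c <;> simp [kahlerForm]
  map_update_smul' := by
    intro inst v p r a
    obtain rfl : inst = instDecidableEqProd := Subsingleton.elim _ _
    obtain ⟨k, c⟩ := p
    simp only [← Finset.mul_prod_erase Finset.univ _ (Finset.mem_univ k)]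
    have hrest : ∀ a : TangentSpace 𝓘(ℝ, E) x, (∏ j ∈ Finset.univ.erase k,
        kahlerForm g x (Function.update v (k, c) a (j, 0)) (Function.update v (k, c) a (j, 1))) =
        ∏ j ∈ Finset.univ.erase k, kahlerForm g x (v (j, 0)) (v (j, 1)) := by
      intro a
      refine Finset.prod_congr rfl fun j hj => ?_
      have hne : j ≠ k := Finset.ne_of_mem_erase hj
      simp [hne]
    rw [hrest, hrest, smul_eq_mul, ← mul_assoc]
    congr 1
    fin_cases c <;> simp [kahlerForm]

/-- The exterior power `ω^m` of the Kähler form at `x`, as an alternating `2m`-form: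
`ω^m (v) = 2^{-m} ∑_σ sgn(σ) ∏_j ω(v_{σ(j,0)}, v_{σ(j,1)})`. -/
def kahlerPower (g : HermitianMetric E M) (m : ℕ) (x : M) :
    TangentSpace 𝓘(ℝ, E) x [⋀^Fin (m * 2)]→L[ℝ] ℝ :=
  { ((1 / 2 : ℝ) ^ m • (MultilinearMap.alternatization (kahlerTensorPower g m x)).domDomCongr
      (finProdFinEquiv : Fin m × Fin 2 ≃ Fin (m * 2))) with
    cont := by
      change Continuous fun v : Fin (m * 2) → TangentSpace 𝓘(ℝ, E) x =>
        (1 / 2 : ℝ) ^ m • MultilinearMap.alternatization (kahlerTensorPower g m x)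
          (fun p => v (finProdFinEquiv p))
      simp only [MultilinearMap.alternatization_apply, MultilinearMap.domDomCongr_apply]
      change Continuous fun v : Fin (m * 2) → TangentSpace 𝓘(ℝ, E) x =>
        (1 / 2 : ℝ) ^ m • ∑ σ : Equiv.Perm (Fin m × Fin 2), Equiv.Perm.sign σ •
          ∏ j : Fin m, g.inner x (complexStructure x (v (finProdFinEquiv (σ (j, 0)))))
            (v (finProdFinEquiv (σ (j, 1))))
      have hB : ∀ (B : E →L[ℝ] E →L[ℝ] ℝ) (L : E →L[ℝ] E) (i k : Fin (m * 2)),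
          Continuous fun v : Fin (m * 2) → E => B (L (v i)) (v k) := by
        intro B L i k
        fun_prop
      have hF : ∀ σ : Equiv.Perm (Fin m × Fin 2), ∀ j : Fin m,
          Continuous fun v : Fin (m * 2) → TangentSpace 𝓘(ℝ, E) x =>
            g.inner x (complexStructure x (v (finProdFinEquiv (σ (j, 0)))))
              (v (finProdFinEquiv (σ (j, 1)))) := fun σ j =>
        hB (g.inner x) (complexStructure x) _ _
      have hP : ∀ σ : Equiv.Perm (Fin m × Fin 2),
          Continuous fun v : Fin (m * 2) → TangentSpace 𝓘(ℝ, E) x => ∏ j : Fin m,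
            g.inner x (complexStructure x (v (finProdFinEquiv (σ (j, 0)))))
              (v (finProdFinEquiv (σ (j, 1)))) := fun σ =>
        continuous_finsetProd _ fun j _ => hF σ j
      exact (continuous_finsetSum _ fun σ _ =>
        (hP σ).const_smul (Equiv.Perm.sign σ)).const_smul ((1 / 2 : ℝ) ^ m) }

end Balanced

/-- The exterior derivative at `x₀` of a differential `k`-form on `M`, computed in the preferred
chart at `x₀` and pulled back to `T_{x₀} M`. -/
def exteriorDerivative {k : ℕ} (α : (x : M) → TangentSpace 𝓘(ℝ, E) x [⋀^Fin k]→L[ℝ] ℝ) (x₀ : M) :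
    TangentSpace 𝓘(ℝ, E) x₀ [⋀^Fin (k + 1)]→L[ℝ] ℝ :=
  ContinuousAlternatingMap.compContinuousLinearMap
    (extDeriv (fun y : E => ((α ((extChartAt 𝓘(ℝ, E) x₀).symm y)).compContinuousLinearMap
      (mfderiv 𝓘(ℝ, E) 𝓘(ℝ, E) (extChartAt 𝓘(ℝ, E) x₀).symm y) : E [⋀^Fin k]→L[ℝ] ℝ))
      (extChartAt 𝓘(ℝ, E) x₀ x₀))
    (mfderiv 𝓘(ℝ, E) 𝓘(ℝ, E) (extChartAt 𝓘(ℝ, E) x₀) x₀)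

/-- The metric is balanced: `d (ω^{n-1}) = 0`, where `n` is the complex dimension. -/
def IsBalanced (g : HermitianMetric E M) : Prop :=
  ∀ x : M, exteriorDerivative (kahlerPower g (Module.finrank ℂ E - 1)) x = 0

end Definitions

end HermitianGeometry

end

noncomputable section

namespace HermitianGeometry

/-! ### Linear algebra: a quadratic torsion identity forces the trace to vanish. -/

section HermitianAlgebra

open scoped RealInnerProductSpace
open LinearMap (adjoint_inner_left adjoint_inner_right)

variable {V : Type*} [NormedAddCommGroup V] [InnerProductSpace ℝ V] [FiniteDimensional ℝ V]

/-! Write T for the Chern torsion, T_x = T(x, ·), T_x* for its metric adjoint, and D for the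
Lichnerowicz connection. The Strominger torsion is minus the cyclic sum of T
(`stromingerTorsion_eq`), so D has torsion τ(x, y) = (T_x* y − T_y* x)/2, and the first Bianchi
identity for D becomes a relation between the covariant derivative DT and terms quadratic in T. T is
complex bilinear and DJ = 0, so DT inherits symmetries under J. Comparing the relation with its
versions in which pairs of arguments are rotated by J isolates one type of derivative term. This
term is skew in the two torsion arguments, so symmetrizing removes it and leaves a purely quadratic
identity for T (`chernTorsion_identity`).

Let H be the vector dual to w ↦ tr T(·, w). A contraction of the quadratic identity shows that T_H
is symmetric. Evaluating it at H shows that K x = T_x* H anticommutes with T_H and that K² = −T_H².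
Hence K conjugates T_H to −T_H on the range of T_H, so tr T_H = 0. But tr T_H = −|H|², so H = 0
(`trace_flip_eq_zero`). Using this real trace at v and at Jv gives η = 0.

For balancedness, the Chern connection preserves ω, so d(ω^{n−1}) at a point is the alternation of
its Christoffel symbols acting on ω^{n−1} (`extDeriv_chartKahlerPower`). Forms of codegree two are
sums of double contractions of top forms ψ. When the torsion is traceless, this algebraic
differential sends the contraction of ψ by x and y to a contraction by ±T(x, y). Since T(Jx, Jy) =
−T(x, y) and J preserves ψ, the differential changes sign when its argument is pulled back by J. As
ω^{n−1} is J-invariant, its differential equals its own negative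
(`christoffelDifferential_eq_zero`). -/

/-- A symmetric endomorphism `a` which anticommutes with some `K` such that `K² = -a²` is
traceless. -/
theorem trace_eq_zero_of_anticommute {a K : V →ₗ[ℝ] V} (ha : a.IsSymmetric)
    (hKa : ∀ v, K (a v) = - a (K v)) (hK : ∀ v, K (K v) = - a (a v)) :
    LinearMap.trace ℝ V a = 0 := by
  set W := LinearMap.range a with hW
  have haW : ∀ v ∈ W, a v ∈ W := fun v _ => ⟨v, rfl⟩
  have hKW : ∀ v ∈ W, K v ∈ W := by
    rintro _ ⟨v, rfl⟩
    exact ⟨-K v, by rw [map_neg, hKa]⟩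
  -- If K (a v) = 0, then a³ v = 0 by K² = −a², and a symmetric nilpotent action is zero, so a v =
  -- 0. Thus K is invertible on the range of a, where it conjugates a to −a.
  have hinj : Function.Injective (K.restrict hKW) := by
    rw [← LinearMap.ker_eq_bot, LinearMap.ker_eq_bot']
    rintro ⟨_, v, rfl⟩ hv
    have hv' : K (a v) = 0 := congrArg Subtype.val hv
    have h1 : a (a (a v)) = 0 := by
      have := hK (a v)
      rw [hv', map_zero] at this
      exact (neg_eq_zero.mp this.symm)
    have h2 : a (a v) = 0 := by
      rw [← inner_self_eq_zero (𝕜 := ℝ), ha, h1, inner_zero_right]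
    have h3 : a v = 0 := by
      rw [← inner_self_eq_zero (𝕜 := ℝ), ha, h2, inner_zero_right]
    exact Subtype.ext h3
  set e : W ≃ₗ[ℝ] W := LinearEquiv.ofInjectiveEndo _ hinj
  have htr := LinearMap.trace_conj' (a.restrict haW) e
  have hconj : e.conj (a.restrict haW) = - a.restrict haW := by
    ext w
    obtain ⟨w, rfl⟩ := e.surjective w
    simp only [LinearEquiv.conj_apply, LinearMap.comp_apply, LinearEquiv.coe_coe,
      LinearEquiv.symm_apply_apply, LinearMap.neg_apply, Submodule.coe_neg]
    change K (a w) = - a (K w)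
    exact hKa w
  rw [hconj, map_neg] at htr
  have hres := LinearMap.trace_restrict_eq_of_forall_mem W a (fun v => ⟨v, rfl⟩)
  rw [← hres]
  linarith

variable {T : V →ₗ[ℝ] V →ₗ[ℝ] V}

set_option maxHeartbeats 1000000 in
/-- The algebraic identity satisfied by the Chern torsion of a metric with Kähler-like Lichnerowicz
connection forces the torsion to be traceless. -/
theorem trace_flip_eq_zero (hT : ∀ x y, T x y = - T y x)
    (hC : ∀ u v X Y, ⟪T ((T X).adjoint u) v, Y⟫ + ⟪T u ((T X).adjoint v), Y⟫ +
      ⟪T ((T Y).adjoint u) v, X⟫ + ⟪T u ((T Y).adjoint v), X⟫ = 0) (v : V) :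
    LinearMap.trace ℝ V (T.flip v) = 0 := by
  have hTT : ∀ x, T x x = 0 := fun x => by
    have h : (2 : ℝ) • T x x = 0 := by
      rw [two_smul]
      nth_rewrite 1 [hT x x]
      exact neg_add_cancel _
    simpa using h
  let e := stdOrthonormalBasis ℝ V
  -- H is the metric dual of the trace form to be killed; see `htr`.
  obtain ⟨H, hHdef⟩ : ∃ H : V, H = ∑ i, (T (e i)).adjoint (e i) := ⟨_, rfl⟩
  have hH : ∀ w, ⟪H, w⟫ = ∑ i, ⟪e i, T (e i) w⟫ := fun w => by
    simp only [hHdef, sum_inner, adjoint_inner_left]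
  have htr : ∀ w, LinearMap.trace ℝ V (T.flip w) = ⟪H, w⟫ := fun w => by
    rw [hH, LinearMap.trace_eq_sum_inner _ e]
    rfl
  -- Set u = X = e_i in the quadratic identity and sum over i.
  have hcontr : ∀ v Y, ⟪T H v, Y⟫ + ∑ i, ⟪(T (e i)).adjoint v, (T (e i)).adjoint Y⟫ -
      ∑ i, ⟪(T Y).adjoint (e i), (T v).adjoint (e i)⟫ - ⟪T H Y, v⟫ = 0 := by
    intro v Y
    have h1 : ⟪T H v, Y⟫ = ∑ i, ⟪T ((T (e i)).adjoint (e i)) v, Y⟫ := by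
      simp only [hHdef, map_sum, LinearMap.sum_apply, sum_inner]
    have h2 : ∑ i, ⟪(T (e i)).adjoint v, (T (e i)).adjoint Y⟫ =
        ∑ i, ⟪T (e i) ((T (e i)).adjoint v), Y⟫ := by
      simp only [adjoint_inner_right]
    have h3 : ∑ i, ⟪(T Y).adjoint (e i), (T v).adjoint (e i)⟫ =
        - ∑ i, ⟪T ((T Y).adjoint (e i)) v, e i⟫ := by
      rw [← Finset.sum_neg_distrib]
      refine Finset.sum_congr rfl fun i _ => ?_
      rw [adjoint_inner_right, hT v, inner_neg_left]
    have h4 : ⟪T H Y, v⟫ = - ∑ i, ⟪T (e i) ((T Y).adjoint v), e i⟫ := by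
      rw [hT H Y, inner_neg_left, ← adjoint_inner_right, hH]
      simp only [fun i => real_inner_comm (e i)]
    rw [h1, h2, h3, h4, sub_neg_eq_add, sub_neg_eq_add, ← Finset.sum_add_distrib,
      ← Finset.sum_add_distrib, ← Finset.sum_add_distrib]
    exact Finset.sum_eq_zero fun i _ => hC (e i) v (e i) Y
  -- The two sums in `hcontr` are symmetric in v and Y, while the remaining two terms form the skew
  -- part of T_H, which therefore vanishes.
  have hsymm : (T H).IsSymmetric := by
    intro v Y
    have h1 := hcontr v Y
    have h2 := hcontr Y v
    rw [Finset.sum_congr rfl fun i _ => real_inner_comm ((T (e i)).adjoint v) _,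
      Finset.sum_congr rfl fun i _ => real_inner_comm ((T Y).adjoint (e i)) _] at h2
    rw [real_inner_comm (T H Y) v]
    linarith
  have hadj : (T H).adjoint = T H := (LinearMap.isSymmetric_iff_isSelfAdjoint _).mp hsymm
  obtain ⟨K, hKdef⟩ : ∃ K : V →ₗ[ℝ] V, ∀ x, K x = (T x).adjoint H :=
    ⟨{ toFun := fun x => (T x).adjoint H
       map_add' := fun x y => by simp
       map_smul' := fun c x => by simp }, fun _ => rfl⟩
  have hK : ∀ x w, ⟪K x, w⟫ = ⟪H, T x w⟫ := fun x w => by rw [hKdef, adjoint_inner_left]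
  have hKskew : ∀ x w, ⟪K x, w⟫ = - ⟪x, K w⟫ := fun x w => by
    rw [hK, hT, inner_neg_right, ← hK, real_inner_comm]
  -- The quadratic identity with X = Y = H.
  have hKa : ∀ w, K (T H w) = - T H (K w) := by
    intro w
    refine ext_inner_right ℝ fun v => ?_
    have := hC w v H H
    rw [hadj] at this
    have h1 : ⟪T (T H w) v, H⟫ + ⟪T w (T H v), H⟫ = 0 := by linarith
    rw [real_inner_comm, ← hK, real_inner_comm H, ← hK, ← hsymm] at h1
    rw [inner_neg_left]
    linarith
  -- The quadratic identity with v = Y = H. Two terms drop because T_H is symmetric and T_H H = 0.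
  have hKK : ∀ w, K (K w) = - T H (T H w) := by
    intro w
    refine ext_inner_right ℝ fun X => ?_
    have := hC w H X H
    rw [hadj, hTT, map_zero, inner_zero_left, hT _ H, inner_neg_left, hsymm, hTT, inner_zero_right,
      hT _ H, inner_neg_left, real_inner_comm, ← hK] at this
    rw [hKskew, inner_neg_left, real_inner_comm]
    rw [← hKdef] at this
    rw [real_inner_comm] at this
    linarith
  have h0 := trace_eq_zero_of_anticommute hsymm hKa hKK
  -- Hence 0 = tr T_H = −|H|².
  have hflip : T H = - T.flip H := by
    ext w
    simp [hT H w]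
  rw [hflip, map_neg, htr, neg_eq_zero, inner_self_eq_zero] at h0
  rw [htr, h0, inner_zero_left]

end HermitianAlgebra

/-! ### The Bianchi identity split by J-type. -/

section HermitianAlgebra

open scoped RealInnerProductSpace
open LinearMap (adjoint_inner_left adjoint_inner_right)

variable {V : Type*} [NormedAddCommGroup V] [InnerProductSpace ℝ V]
  {T : V →ₗ[ℝ] V →ₗ[ℝ] V} {J : V →ₗ[ℝ] V}

theorem complexLinear_right (hT : ∀ x y, T x y = - T y x) (hTJ : ∀ x y, T (J x) y = J (T x y))
    (x y : V) : T x (J y) = J (T x y) := by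
  rw [hT, hTJ, ← map_neg, ← hT]

theorem inner_complexStructure_left (hJJ : ∀ x, J (J x) = -x) (hJ : ∀ x y, ⟪J x, J y⟫ = ⟪x, y⟫)
    (x y : V) : ⟪J x, y⟫ = - ⟪x, J y⟫ := by
  rw [← hJ x (J y), hJJ, inner_neg_right, neg_neg]

variable [FiniteDimensional ℝ V]

/-- T is complex linear in y and J is skew, so passing to the adjoint makes the dependence on y
conjugate linear. -/
theorem adjoint_complexStructure_left (hJJ : ∀ x, J (J x) = -x)
    (hJ : ∀ x y, ⟪J x, J y⟫ = ⟪x, y⟫) (hT : ∀ x y, T x y = - T y x)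
    (hTJ : ∀ x y, T (J x) y = J (T x y)) (x y : V) :
    (T (J y)).adjoint x = - J ((T y).adjoint x) := by
  refine ext_inner_right ℝ fun w => ?_
  rw [adjoint_inner_left, inner_neg_left, inner_complexStructure_left hJJ hJ, adjoint_inner_left,
    complexLinear_right hT hTJ, hTJ, neg_neg]

theorem adjoint_complexStructure_right (hJJ : ∀ x, J (J x) = -x)
    (hJ : ∀ x y, ⟪J x, J y⟫ = ⟪x, y⟫) (hT : ∀ x y, T x y = - T y x)
    (hTJ : ∀ x y, T (J x) y = J (T x y)) (x y : V) :
    (T y).adjoint (J x) = J ((T y).adjoint x) := by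
  refine ext_inner_right ℝ fun w => ?_
  rw [adjoint_inner_left, inner_complexStructure_left hJJ hJ, inner_complexStructure_left hJJ hJ,
    adjoint_inner_left, complexLinear_right hT hTJ]

/-- The torsion `τ` of the Lichnerowicz connection in terms of the Chern torsion `T`. -/
theorem lichnerowiczTorsion_eq_adjoint {τ : V → V → V} (hT : ∀ x y, T x y = - T y x)
    (hτ : ∀ x y z, ⟪τ x y, z⟫ = -(1 / 2) * (⟪T y z, x⟫ + ⟪T z x, y⟫)) (x y : V) :
    τ x y = (1 / 2 : ℝ) • ((T x).adjoint y - (T y).adjoint x) := by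
  refine ext_inner_right ℝ fun z => ?_
  rw [hτ, real_inner_smul_left, inner_sub_left, adjoint_inner_left, adjoint_inner_left, hT z x,
    inner_neg_left, real_inner_comm x, real_inner_comm y]
  ring

/-- Written through T and its adjoints, the quadratic side of the Bianchi identity changes only by
signs when pairs of arguments are rotated by J. -/
theorem inner_lichnerowiczTorsion_comp {τ : V → V → V} (hT : ∀ x y, T x y = - T y x)
    (hτ : ∀ x y z, ⟪τ x y, z⟫ = -(1 / 2) * (⟪T y z, x⟫ + ⟪T z x, y⟫)) (x y z w : V) :
    ⟪τ (τ x y) z, w⟫ = (1 / 4) * (⟪T z w, (T y).adjoint x⟫ - ⟪T z w, (T x).adjoint y⟫ +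
      ⟪T w ((T y).adjoint x), z⟫ - ⟪T w ((T x).adjoint y), z⟫) := by
  rw [hτ, lichnerowiczTorsion_eq_adjoint hT hτ x y, map_smul, map_sub, real_inner_smul_left,
    real_inner_smul_right, inner_sub_right, inner_sub_left]
  ring

/-- Here M x y z w stands for g((D_x T)(y, z), w) with D the Lichnerowicz connection, and `hB` is
its first Bianchi identity. The conclusion no longer contains M: it is what remains after separating
J-types and symmetrizing in X and Y. -/
theorem chernTorsion_identity {τ : V → V → V} {M : V → V → V → V → ℝ}
    (hJJ : ∀ x, J (J x) = -x)
    (hJ : ∀ x y, ⟪J x, J y⟫ = ⟪x, y⟫) (hT : ∀ x y, T x y = - T y x)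
    (hTJ : ∀ x y, T (J x) y = J (T x y))
    (hτ : ∀ x y z, ⟪τ x y, z⟫ = -(1 / 2) * (⟪T y z, x⟫ + ⟪T z x, y⟫))
    (hM : ∀ x y z w, M x y z w = - M x z y w)
    (hMJ : ∀ x y z w, M x (J y) (J z) w = - M x y z w)
    (hMJ' : ∀ x y z w, M x (J y) z (J w) = M x y z w)
    (hB : ∀ x y z w, M x z w y - M y z w x + M y x w z - M z x w y + M z y w x - M x y w z =
      2 * (⟪τ (τ x y) z, w⟫ + ⟪τ (τ y z) x, w⟫ + ⟪τ (τ z x) y, w⟫)) (u v X Y : V) :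
    ⟪T ((T X).adjoint u) v, Y⟫ + ⟪T u ((T X).adjoint v), Y⟫ +
      ⟪T ((T Y).adjoint u) v, X⟫ + ⟪T u ((T Y).adjoint v), X⟫ = 0 := by
  have hTJ' := complexLinear_right hT hTJ
  have hA := adjoint_complexStructure_left hJJ hJ hT hTJ
  have hA' := adjoint_complexStructure_right hJJ hJ hT hTJ
  -- Take `hB` at (x, y, z, w) and (Jx, Jy, Jz, Jw) with sign +, and at (x, y, Jz, Jw) and (Jx, Jy,
  -- z, w) with sign −. All derivative terms cancel except those with z and w as torsion arguments,
  -- which double.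
  have key : ∀ x y z w, M x z w y - M y z w x - M (J x) z w (J y) + M (J y) z w (J x) =
      ⟪T w ((T x).adjoint z), y⟫ - ⟪T w ((T y).adjoint z), x⟫ := by
    intro x y z w
    have h1 := hB x y z w
    have h2 := hB x y (J z) (J w)
    have h3 := hB (J x) (J y) z w
    have h4 := hB (J x) (J y) (J z) (J w)
    have hMJ'' : ∀ x y z w, M x y (J z) (J w) = M x y z w := fun x y z w => by
      rw [hM, hMJ', ← hM]
    rw [hMJ x z w y, hMJ y z w x, hMJ'' y x w z, hMJ'' x y w z] at h2
    rw [hMJ' z x w y, hMJ' z y w x] at h3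
    rw [hMJ (J x) z w, hMJ (J y) z w, hMJ'' (J y) (J x) w z, hMJ' (J z) x (J w) y,
      hMJ' (J z) y (J w) x, hMJ'' (J x) (J y) w z] at h4
    simp only [inner_lichnerowiczTorsion_comp hT hτ, hTJ, hTJ', hA, hA', hJ, hJJ, map_neg,
      inner_neg_left, inner_neg_right, neg_neg] at h1 h2 h3 h4
    linarith
  -- The left side of `key` is skew in its last two arguments, so adding the instances with X and Y
  -- exchanged leaves only torsion terms.
  have hsum := key u v X Y
  have hsum' := key u v Y X
  have e : ∀ a b c d, ⟪T a ((T b).adjoint c), d⟫ = ⟪T b ((T a).adjoint d), c⟫ := fun a b c d => by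
    rw [← adjoint_inner_right, real_inner_comm, adjoint_inner_right]
  rw [hM u Y, hM v Y, hM (J u) Y, hM (J v) Y] at hsum'
  rw [hT _ v, hT _ v, inner_neg_left, inner_neg_left, e v, e v, e u, e u]
  linarith

end HermitianAlgebra

/-! ### Strominger torsion from Chern torsion, and the Bianchi identity in coordinates. -/

section HermitianAlgebra

open scoped RealInnerProductSpace

variable {V : Type*} [NormedAddCommGroup V] [InnerProductSpace ℝ V]
  {T : V →ₗ[ℝ] V →ₗ[ℝ] V} {J : V →ₗ[ℝ] V}

/-- The Strominger torsion `S` in terms of the Chern torsion `T`, where `Γ` is the difference of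
the two connections. -/
theorem stromingerTorsion_eq {S : V →ₗ[ℝ] V →ₗ[ℝ] V} {Γ : V → V → V}
    (hJJ : ∀ x, J (J x) = -x) (hJ : ∀ x y, ⟪J x, J y⟫ = ⟪x, y⟫) (hT : ∀ x y, T x y = - T y x)
    (hTJ : ∀ x y, T (J x) y = J (T x y)) (hΓ : ∀ x y z, ⟪Γ x y, z⟫ = - ⟪y, Γ x z⟫)
    (hΓJ : ∀ x y, Γ x (J y) = J (Γ x y)) (hST : ∀ x y, S x y = T x y + Γ x y - Γ y x)
    (hS : ∀ x y z, ⟪S x y, z⟫ = - ⟪S x z, y⟫) (x y z : V) :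
    ⟪S x y, z⟫ = - (⟪T x y, z⟫ + ⟪T y z, x⟫ + ⟪T z x, y⟫) := by
  have hTJ' := complexLinear_right hT hTJ
  have hc : ∀ x y z, ⟪Γ x y, z⟫ = - ⟪Γ x z, y⟫ := fun x y z => by rw [hΓ, real_inner_comm]
  have hs : ∀ x y z, ⟪S x y, z⟫ = ⟪T x y, z⟫ + ⟪Γ x y, z⟫ - ⟪Γ y x, z⟫ := fun x y z => by
    rw [hST, inner_sub_left, inner_add_left]
  have hq : ∀ x y z, ⟪T x y, z⟫ = - ⟪T y x, z⟫ := fun x y z => by rw [hT, inner_neg_left]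
  have hsk : ∀ x y z, ⟪S x y, z⟫ = - ⟪S y x, z⟫ := fun x y z => by
    rw [hs, hs, hq]; ring
  -- Skewness of Γ_x recovers Γ from S − T as in Koszul's formula (`hk`). Comparing with the same
  -- formula at (x, Jy, Jz), where Γ takes the same value because it commutes with J, gives the
  -- claim.
  have h1 : ∀ x y z, ⟪S x (J y), J z⟫ = ⟪S x y, z⟫ + 2 * ⟪T y z, x⟫ := by
    intro x y z
    have hk : ∀ x y z, 2 * ⟪Γ x y, z⟫ =
        ⟪S x y, z⟫ - ⟪T x y, z⟫ + ⟪T y z, x⟫ - ⟪T z x, y⟫ := fun x y z => by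
      linarith [hs x y z, hs y z x, hs z x y, hc x y z, hc y z x, hc z x y, hS x y z, hS y z x,
        hS z x y, hsk x y z, hsk x z y, hsk z x y]
    have e1 := hk x y z
    have e2 := hk x (J y) (J z)
    rw [hΓJ, hJ, hTJ', hJ, hTJ, hTJ', hJJ, inner_neg_left, hTJ, hJ] at e2
    linarith
  -- `h1` in each of the three slots, together with one mixed instance `e4`, is a linear system that
  -- determines S(Jx, Jy, Jz).
  have h2 : ∀ x y z, ⟪S (J x) (J y), J z⟫ = ⟪T y z, J x⟫ + ⟪T z x, J y⟫ + ⟪T x y, J z⟫ := by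
    intro x y z
    have e1 := h1 (J x) y z
    have e2 := h1 (J y) z x
    have e3 := h1 (J z) x y
    have e4 := h1 x (J y) z
    rw [hJJ, map_neg, inner_neg_left, hTJ,
      inner_complexStructure_left hJJ hJ] at e4
    linarith [hS (J x) (J y) (J z), hS (J y) (J z) (J x), hS (J z) (J x) (J y),
      hsk (J x) (J y) (J z), hsk (J y) (J z) (J x), hsk (J z) (J x) (J y), hsk (J y) z x,
      hS z (J y) x, hsk z x (J y), hS x (J y) z, hS x z (J y), hsk (J z) x y, hS x (J z) y]
  have e := h2 (J x) (J y) (J z)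
  simp only [hJJ, map_neg, LinearMap.neg_apply, inner_neg_left, inner_neg_right, hTJ, hTJ'] at e
  linarith

variable [FiniteDimensional ℝ V]

/-- If a connection with Chern torsion `T` has a Lichnerowicz connection satisfying the first
Bianchi identity, then `T` is traceless. Here `Γ` are the Christoffel symbols of the Lichnerowicz
connection and `dt` is the derivative of the coefficients of `T` in holomorphic coordinates. -/
theorem trace_flip_eq_zero_of_bianchi {τ Γ : V → V → V} {dt : V → V → V → V → ℝ}
    (hJJ : ∀ x, J (J x) = -x) (hJ : ∀ x y, ⟪J x, J y⟫ = ⟪x, y⟫) (hT : ∀ x y, T x y = - T y x)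
    (hTJ : ∀ x y, T (J x) y = J (T x y))
    (hτ : ∀ x y z, ⟪τ x y, z⟫ = -(1 / 2) * (⟪T y z, x⟫ + ⟪T z x, y⟫))
    (hΓJ : ∀ x y, Γ x (J y) = J (Γ x y)) (hΓ : ∀ x y, Γ x y - Γ y x = τ x y)
    (hdt : ∀ x y z w, dt x y z w = - dt x z y w)
    (hdtJ : ∀ x y z w, dt x (J y) (J z) w = - dt x y z w)
    (hdtJ' : ∀ x y z w, dt x (J y) z (J w) = dt x y z w)
    (hB : ∀ x y z w,
      (-(1 / 2) * (dt x z w y + dt x w y z) - ⟪τ y z, Γ x w⟫) +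
      (-(1 / 2) * (dt y x w z + dt y w z x) - ⟪τ z x, Γ y w⟫) +
      (-(1 / 2) * (dt z y w x + dt z w x y) - ⟪τ x y, Γ z w⟫) = 0) (v : V) :
    LinearMap.trace ℝ V (T.flip v) = 0 := by
  have hTJ' := complexLinear_right hT hTJ
  have hq : ∀ x y z, ⟪T x y, z⟫ = - ⟪T y x, z⟫ := fun x y z => by rw [hT, inner_neg_left]
  -- M is the covariant derivative of T: the derivative of its coefficients corrected by a
  -- Christoffel term in each slot.
  refine trace_flip_eq_zero hT (chernTorsion_identity (τ := τ)
    (M := fun x y z w => dt x y z w - ⟪T (Γ x y) z, w⟫ - ⟪T y (Γ x z), w⟫ - ⟪T y z, Γ x w⟫)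
    hJJ hJ hT hTJ hτ ?_ ?_ ?_ ?_) v
  · intro x y z w
    rw [hdt, hq (Γ x y), hq y, hq y]
    ring
  · intro x y z w
    simp only [hΓJ, hTJ, hTJ', hJJ, inner_neg_left, hdtJ]
    ring
  · intro x y z w
    simp only [hΓJ, hTJ, hJ, hdtJ']
  · intro x y z w
    have hB' := hB x y z w
    have hττ : ∀ x y z w, ⟪τ (τ x y) z, w⟫ = -(1 / 2) * (⟪T z w, Γ x y⟫ - ⟪T z w, Γ y x⟫ +
        ⟪T w (Γ x y), z⟫ - ⟪T w (Γ y x), z⟫) := fun x y z w => by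
      rw [hτ, ← hΓ, map_sub, inner_sub_right, inner_sub_left]
      ring
    simp only [hττ]
    simp only [hτ] at hB'
    linarith [hdt x w y z, hdt y w z x, hdt z w x y, hq (Γ x w) y z, hq (Γ x w) z y,
      hq (Γ y w) x z, hq (Γ y w) z x, hq (Γ z w) y x, hq (Γ z w) x y,
      hq (Γ x y) w z, hq (Γ x z) w y, hq (Γ y x) w z, hq (Γ y z) w x, hq (Γ z x) w y,
      hq (Γ z y) w x, hq z w (Γ x y), hq z w (Γ y x), hq x w (Γ y z), hq x w (Γ z y),
      hq y w (Γ x z), hq y w (Γ z x)]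

end HermitianAlgebra

/-! ### Alternating forms of codegree two and traceless torsion. -/

section ExteriorAlgebra

open AlternatingMap (curryLeft curryLeftLinearMap curryLeft_apply_apply alternatizeUncurryFin
  alternatizeUncurryFinLM alternatizeUncurryFinLM_apply alternatizeUncurryFin_apply
  alternatizeUncurryFin_add alternatizeUncurryFin_smul alternatizeUncurryFin_curryLeft
  neg_one_pow_smul_map_insertNth)
open Function

variable {V : Type*} [AddCommGroup V] [Module ℝ V]

/-- The interior product of a vector with an alternating form. -/
def interior {k : ℕ} (x : V) : (V [⋀^Fin (k + 1)]→ₗ[ℝ] ℝ) →ₗ[ℝ] V [⋀^Fin k]→ₗ[ℝ] ℝ :=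
  curryLeftLinearMap.flip x

theorem interior_apply {k : ℕ} (x : V) (α : V [⋀^Fin (k + 1)]→ₗ[ℝ] ℝ) (v : Fin k → V) :
    interior x α v = α (Matrix.vecCons x v) := rfl

theorem interior_eq_curryLeft {k : ℕ} (x : V) (α : V [⋀^Fin (k + 1)]→ₗ[ℝ] ℝ) :
    interior x α = α.curryLeft x := rfl

theorem interior_neg {k : ℕ} (x : V) (α : V [⋀^Fin (k + 1)]→ₗ[ℝ] ℝ) :
    interior (-x) α = - interior x α :=
  α.curryLeft.map_neg x

theorem interior_compLinearMap {k : ℕ} (J : V →ₗ[ℝ] V) (x : V) (α : V [⋀^Fin (k + 1)]→ₗ[ℝ] ℝ) :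
    interior x (α.compLinearMap J) = (interior (J x) α).compLinearMap J :=
  AlternatingMap.curryLeft_compLinearMap J α x

theorem interior_alternatizeUncurryFin {k : ℕ} (f : V →ₗ[ℝ] V [⋀^Fin (k + 1)]→ₗ[ℝ] ℝ) (x : V) :
    interior x (alternatizeUncurryFin f) = f x - alternatizeUncurryFin (interior x ∘ₗ f) := by
  ext v
  rw [interior_apply, alternatizeUncurryFin_apply, Fin.sum_univ_succ, AlternatingMap.sub_apply,
    alternatizeUncurryFin_apply, sub_eq_add_neg, ← Finset.sum_neg_distrib]
  congr 1
  · simp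
  · refine Finset.sum_congr rfl fun i _ => ?_
    have h : Fin.removeNth i.succ (Matrix.vecCons x v) = Matrix.vecCons x (Fin.removeNth i v) := by
      ext j
      refine Fin.cases ?_ (fun j => ?_) j <;> simp [Fin.removeNth]
    rw [h]
    simp [pow_succ, interior_apply]

/-- The action of an endomorphism on alternating forms as a derivation (up to sign). -/
def derivationAction :
    {k : ℕ} → (V [⋀^Fin k]→ₗ[ℝ] ℝ) →ₗ[ℝ] (V →ₗ[ℝ] V) →ₗ[ℝ] V [⋀^Fin k]→ₗ[ℝ] ℝ
  | 0 => 0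
  | _ + 1 =>
    { toFun := fun α => alternatizeUncurryFinLM ∘ₗ LinearMap.llcomp ℝ V V _ α.curryLeft
      map_add' := fun α β => by
        ext; simp [alternatizeUncurryFin_apply]
      map_smul' := fun c α => by
        ext; simp [alternatizeUncurryFin_apply, Finset.mul_sum] }

theorem derivationAction_eq {k : ℕ} (α : V [⋀^Fin (k + 1)]→ₗ[ℝ] ℝ) (A : V →ₗ[ℝ] V) :
    derivationAction α A = alternatizeUncurryFin (α.curryLeft ∘ₗ A) := rfl

theorem derivationAction_apply {k : ℕ} (α : V [⋀^Fin k]→ₗ[ℝ] ℝ) (A : V →ₗ[ℝ] V) (v : Fin k → V) :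
    derivationAction α A v = ∑ j, α (update v j (A (v j))) := by
  cases k with
  | zero => simp [derivationAction]
  | succ k =>
    rw [derivationAction_eq, alternatizeUncurryFin_apply]
    refine Finset.sum_congr rfl fun j _ => ?_
    rw [LinearMap.comp_apply, curryLeft_apply_apply, ← neg_one_pow_smul_map_insertNth, smul_smul,
      ← pow_add, Even.neg_one_pow ⟨_, rfl⟩, one_smul, Fin.insertNth_removeNth]

theorem interior_derivationAction {k : ℕ} (α : V [⋀^Fin (k + 1)]→ₗ[ℝ] ℝ) (A : V →ₗ[ℝ] V) (x : V) :
    interior x (derivationAction α A) = interior (A x) α + derivationAction (interior x α) A := by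
  ext v
  rw [interior_apply, derivationAction_apply, Fin.sum_univ_succ, AlternatingMap.add_apply, derivationAction_apply]
  congr 1
  · rw [interior_apply]
    congr 1
    ext j
    refine Fin.cases ?_ (fun j => ?_) j <;> simp
  · refine Finset.sum_congr rfl fun i _ => ?_
    rw [interior_apply]
    congr 1
    ext j
    refine Fin.cases ?_ (fun j => ?_) j
    · simp [Function.update_of_ne (Fin.succ_ne_zero i).symm]
    · simp [Function.update_apply]

/-- The exterior covariant differential of a form with constant coefficients with respect to a
connection with Christoffel symbols `Γ`, up to sign. -/
def christoffelDifferential {k : ℕ} (Γ : V →ₗ[ℝ] V →ₗ[ℝ] V) :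
    (V [⋀^Fin k]→ₗ[ℝ] ℝ) →ₗ[ℝ] V [⋀^Fin (k + 1)]→ₗ[ℝ] ℝ where
  toFun α := alternatizeUncurryFin (derivationAction α ∘ₗ Γ)
  map_add' α β := by
    rw [map_add, LinearMap.add_comp, alternatizeUncurryFin_add]
  map_smul' c α := by
    rw [map_smul, LinearMap.smul_comp, alternatizeUncurryFin_smul, RingHom.id_apply]

/-- A Cartan formula: on contraction, Γ survives outside the differential only through its skew
part, the torsion. -/
theorem interior_christoffelDifferential {k : ℕ} (Γ : V →ₗ[ℝ] V →ₗ[ℝ] V)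
    (α : V [⋀^Fin (k + 1)]→ₗ[ℝ] ℝ) (x : V) :
    interior x (christoffelDifferential Γ α) =
      derivationAction α (Γ x - Γ.flip x) - christoffelDifferential Γ (interior x α) := by
  have h : interior x ∘ₗ (derivationAction α ∘ₗ Γ) =
      α.curryLeft ∘ₗ Γ.flip x + derivationAction (interior x α) ∘ₗ Γ := by
    refine LinearMap.ext fun y => ?_
    simp only [LinearMap.comp_apply, LinearMap.add_apply, interior_derivationAction]
    rfl
  change interior x (alternatizeUncurryFin _) = _
  rw [interior_alternatizeUncurryFin, h, alternatizeUncurryFin_add, map_sub, ← derivationAction_eq]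
  change _ - (_ + christoffelDifferential Γ (interior x α)) = _
  simp only [LinearMap.comp_apply]
  abel

/-- An endomorphism acts on a top form by multiplication by its trace, as evaluation on a basis
shows. -/
theorem derivationAction_eq_zero_of_trace_eq_zero [FiniteDimensional ℝ V] {k : ℕ}
    (hk : Module.finrank ℝ V = k) (α : V [⋀^Fin k]→ₗ[ℝ] ℝ) {A : V →ₗ[ℝ] V}
    (hA : LinearMap.trace ℝ V A = 0) : derivationAction α A = 0 := by
  let e : Module.Basis (Fin k) ℝ V := Module.finBasisOfFinrankEq ℝ V hk
  rw [AlternatingMap.eq_smul_basis_det e (derivationAction α A)]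
  have h : derivationAction α A e = LinearMap.trace ℝ V A * α e := by
    rw [derivationAction_apply, LinearMap.trace_eq_matrix_trace ℝ e, Matrix.trace, Finset.sum_mul]
    refine Finset.sum_congr rfl fun j _ => ?_
    rw [Matrix.diag_apply, LinearMap.toMatrix_apply]
    conv_lhs => rw [← e.sum_repr (A (e j))]
    rw [AlternatingMap.map_update_sum, Finset.sum_eq_single j]
    · rw [AlternatingMap.map_update_smul, update_eq_self, smul_eq_mul]
    · intro i _ hij
      rw [AlternatingMap.map_update_smul, AlternatingMap.map_update_self _ _ hij.symm, smul_zero]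
    · simp
  rw [h, hA, zero_mul, zero_smul]

theorem alternatingMap_eq_zero_of_finrank_lt [FiniteDimensional ℝ V] {k : ℕ}
    (hk : Module.finrank ℝ V < k) (α : V [⋀^Fin k]→ₗ[ℝ] ℝ) : α = 0 := by
  ext v
  refine α.map_linearDependent v fun h => ?_
  have := h.fintype_card_le_finrank
  simp at this
  omega

/-- Apply the Cartan formula twice. The differential of ψ has degree above the dimension, and the
traceless torsion annihilates ψ, so only the contraction by the torsion of x and y is left. -/
theorem christoffelDifferential_interior_interior [FiniteDimensional ℝ V] {k : ℕ}
    (hk : Module.finrank ℝ V = k + 2) {Γ : V →ₗ[ℝ] V →ₗ[ℝ] V}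
    (htr : ∀ x, LinearMap.trace ℝ V (Γ x - Γ.flip x) = 0) (ψ : V [⋀^Fin (k + 2)]→ₗ[ℝ] ℝ) (x y : V) :
    christoffelDifferential Γ (interior y (interior x ψ)) = - interior (Γ y x - Γ x y) ψ := by
  have h0 : ∀ x, derivationAction ψ (Γ x - Γ.flip x) = 0 := fun x =>
    derivationAction_eq_zero_of_trace_eq_zero hk ψ (htr x)
  have h1 : christoffelDifferential Γ (interior x ψ) = 0 := by
    have h := interior_christoffelDifferential Γ ψ x
    rw [alternatingMap_eq_zero_of_finrank_lt (by omega) (christoffelDifferential Γ ψ), map_zero,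
      h0, zero_sub, eq_comm, neg_eq_zero] at h
    exact h
  have h2 := interior_christoffelDifferential Γ (interior x ψ) y
  rw [h1, map_zero, eq_comm, sub_eq_zero] at h2
  have h3 := interior_derivationAction ψ (Γ y - Γ.flip y) x
  rw [h0, map_zero, eq_comm, ← neg_eq_iff_add_eq_zero] at h3
  rw [← h2, ← h3]
  rfl

/-- The sum of i_{b_i}(b^i ∧ α) counts the basis directions missing from α. It serves to write forms
of low codegree as sums of contractions. -/
theorem sum_interior_wedge [FiniteDimensional ℝ V] {ι : Type*} [Fintype ι]
    (b : Module.Basis ι ℝ V) {k : ℕ} (α : V [⋀^Fin k]→ₗ[ℝ] ℝ) :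
    ∑ i, interior (b i) (alternatizeUncurryFin ((b.coord i).smulRight α)) =
      ((Fintype.card ι : ℝ) - k) • α := by
  cases k with
  | zero =>
    have h : ∀ i, interior (b i) (alternatizeUncurryFin ((b.coord i).smulRight α)) = α := by
      intro i
      ext v
      simp [interior_apply, alternatizeUncurryFin_apply, Subsingleton.elim (α := Fin 0 → V) _ v]
    rw [Finset.sum_congr rfl fun i _ => h i, Finset.sum_const, Finset.card_univ,
      ← Nat.cast_smul_eq_nsmul ℝ]
    simp
  | succ k =>
    have h : ∑ i, interior (b i) ∘ₗ (b.coord i).smulRight α = α.curryLeft := by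
      refine LinearMap.ext fun x => ?_
      conv_rhs => rw [← b.sum_repr x, map_sum]
      rw [LinearMap.sum_apply]
      refine Finset.sum_congr rfl fun i _ => ?_
      simp [interior_eq_curryLeft]
    simp only [interior_alternatizeUncurryFin, Finset.sum_sub_distrib]
    simp only [← alternatizeUncurryFinLM_apply]
    rw [← map_sum, h, alternatizeUncurryFinLM_apply, alternatizeUncurryFin_curryLeft]
    ext v
    simp [sub_mul]

/-- Forms of codegree two are sums of double contractions of volume forms. -/
theorem eq_of_eq_on_interior_interior [FiniteDimensional ℝ V] {W : Type*} [AddCommGroup W]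
    [Module ℝ W] {k : ℕ} (hk : Module.finrank ℝ V = k + 2) {F G : (V [⋀^Fin k]→ₗ[ℝ] ℝ) →ₗ[ℝ] W}
    (hFG : ∀ (ψ : V [⋀^Fin (k + 2)]→ₗ[ℝ] ℝ) (x y : V),
      F (interior y (interior x ψ)) = G (interior y (interior x ψ))) : F = G := by
  let b : Module.Basis (Fin (k + 2)) ℝ V := Module.finBasisOfFinrankEq ℝ V hk
  -- The counting factor is 1 in codegree one and 2 in codegree two, nonzero both times, so two
  -- successive contractions reach every form.
  have h1 : ∀ (β : V [⋀^Fin (k + 1)]→ₗ[ℝ] ℝ) (y : V), F (interior y β) = G (interior y β) := by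
    intro β y
    have h := sum_interior_wedge b β
    rw [Fintype.card_fin, show ((k + 2 : ℕ) : ℝ) - ((k + 1 : ℕ) : ℝ) = 1 by push_cast; ring,
      one_smul] at h
    rw [← h]
    simp only [map_sum, hFG]
  refine LinearMap.ext fun α => ?_
  have h := sum_interior_wedge b α
  rw [Fintype.card_fin, show ((k + 2 : ℕ) : ℝ) - (k : ℝ) = 2 by push_cast; ring] at h
  have h2 : α = (1 / 2 : ℝ) • ((2 : ℝ) • α) := by rw [smul_smul]; norm_num
  rw [h2, ← h]
  simp only [map_smul, map_sum, h1]

/-- From (1 + J)² = 2J the determinant is nonnegative, and from J² = −1 its fourth power is 1. -/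
theorem det_complexStructure [FiniteDimensional ℝ V] {J : V →ₗ[ℝ] V} (hJJ : ∀ x, J (J x) = -x) :
    LinearMap.det J = 1 := by
  have h1 : LinearMap.det J * LinearMap.det J = LinearMap.det (- LinearMap.id : V →ₗ[ℝ] V) := by
    rw [← LinearMap.det_comp]
    congr 1
    exact LinearMap.ext hJJ
  have h2 : LinearMap.det (LinearMap.id + J) * LinearMap.det (LinearMap.id + J) =
      2 ^ Module.finrank ℝ V * LinearMap.det J := by
    rw [← LinearMap.det_comp, ← LinearMap.det_smul]
    congr 1
    refine LinearMap.ext fun x => ?_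
    simp only [LinearMap.comp_apply, LinearMap.add_apply, LinearMap.id_apply, map_add, hJJ,
      two_smul]
    abel
  have h3 : LinearMap.det (- LinearMap.id : V →ₗ[ℝ] V) *
      LinearMap.det (- LinearMap.id : V →ₗ[ℝ] V) = 1 := by
    rw [← LinearMap.det_comp]
    simp
  have h4 : 0 ≤ LinearMap.det J := by
    have : 0 ≤ 2 ^ Module.finrank ℝ V * LinearMap.det J := h2 ▸ mul_self_nonneg _
    exact nonneg_of_mul_nonneg_right this (by positivity)
  rw [← h1] at h3
  have h5 : LinearMap.det J ^ 4 = 1 := by rw [← h3]; ring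
  exact (pow_eq_one_iff_of_nonneg h4 (by norm_num)).mp h5

theorem compLinearMap_complexStructure_of_finrank [FiniteDimensional ℝ V] {k : ℕ}
    (hk : Module.finrank ℝ V = k) {J : V →ₗ[ℝ] V} (hJJ : ∀ x, J (J x) = -x)
    (ψ : V [⋀^Fin k]→ₗ[ℝ] ℝ) : ψ.compLinearMap J = ψ := by
  let e : Module.Basis (Fin k) ℝ V := Module.finBasisOfFinrankEq ℝ V hk
  rw [AlternatingMap.eq_smul_basis_det e ψ]
  ext v
  have h := Module.Basis.det_comp e J v
  rw [det_complexStructure hJJ, one_mul] at h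
  simp only [AlternatingMap.compLinearMap_apply, AlternatingMap.smul_apply]
  congr 1

/-- A `J`-invariant form of codegree two is closed with respect to a traceless complex bilinear
torsion. -/
theorem christoffelDifferential_eq_zero [FiniteDimensional ℝ V] {k : ℕ}
    (hk : Module.finrank ℝ V = k + 2) {Γ : V →ₗ[ℝ] V →ₗ[ℝ] V} {J : V →ₗ[ℝ] V}
    (hJJ : ∀ x, J (J x) = -x)
    (hΓJ : ∀ x y, Γ (J x) (J y) - Γ (J y) (J x) = - (Γ x y - Γ y x))
    (htr : ∀ x, LinearMap.trace ℝ V (Γ x - Γ.flip x) = 0) {α : V [⋀^Fin k]→ₗ[ℝ] ℝ}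
    (hα : α.compLinearMap J = α) : christoffelDifferential Γ α = 0 := by
  let P : (V [⋀^Fin k]→ₗ[ℝ] ℝ) →ₗ[ℝ] (V [⋀^Fin k]→ₗ[ℝ] ℝ) :=
    { toFun := fun β => β.compLinearMap J
      map_add' := fun _ _ => rfl
      map_smul' := fun _ _ => rfl }
  have hP : ∀ (ψ : V [⋀^Fin (k + 2)]→ₗ[ℝ] ℝ) (x y : V),
      P (interior y (interior x ψ)) = interior (J y) (interior (J x) ψ) := by
    intro ψ x y
    conv_rhs => rw [← compLinearMap_complexStructure_of_finrank hk hJJ ψ]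
    rw [interior_compLinearMap, interior_compLinearMap, hJJ, hJJ, interior_neg, interior_neg,
      map_neg, neg_neg]
    rfl
  -- Pullback by J rotates both contracted vectors, and the torsion changes sign when both its
  -- arguments are rotated.
  have h : christoffelDifferential Γ ∘ₗ P = - christoffelDifferential Γ := by
    refine eq_of_eq_on_interior_interior hk fun ψ x y => ?_
    rw [LinearMap.comp_apply, hP, LinearMap.neg_apply,
      christoffelDifferential_interior_interior hk htr,
      christoffelDifferential_interior_interior hk htr, hΓJ]
    simp only [interior_eq_curryLeft, map_neg]
  have h' := LinearMap.congr_fun h α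
  rw [LinearMap.comp_apply, LinearMap.neg_apply, show P α = α from hα] at h'
  have h2 : (2 : ℝ) • christoffelDifferential Γ α = 0 := by
    rw [two_smul]
    nth_rewrite 1 [h']
    exact neg_add_cancel _
  exact (smul_eq_zero.mp h2).resolve_left two_ne_zero

end ExteriorAlgebra

/-! ### Coordinate vector fields of a holomorphic chart. -/

section CoordinateFields

open scoped Topology

variable {E : Type*} [NormedAddCommGroup E] [NormedSpace ℂ E]
  {M : Type*} [TopologicalSpace M] [ChartedSpace E M] [IsManifold 𝓘(ℂ, E) ω M]

/-- The coordinate vector field on the preferred chart at `x₀` with constant value `u`. -/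
def coordField (x₀ : M) (u : E) : VField E M := fun x =>
  (trivializationAt E (TangentSpace 𝓘(ℝ, E) : M → Type _) x₀).symmL ℝ x u

theorem coordField_self (x₀ : M) (u : E) : coordField x₀ u x₀ = u := by
  have h := TangentBundle.symmL_trivializationAt_eq_core (I := 𝓘(ℝ, E)) (mem_chart_source E x₀)
  change (trivializationAt E (TangentSpace 𝓘(ℝ, E) : M → Type _) x₀).symmL ℝ x₀ u = u
  rw [h]
  exact (tangentBundleCore 𝓘(ℝ, E) M).coordChange_self (achart E x₀) x₀ (mem_chart_source E x₀) u

theorem coordField_eq_mfderiv {x₀ x : M} (hx : x ∈ (chartAt E x₀).source) (u : E) :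
    coordField x₀ u x = mfderiv 𝓘(ℝ, E) 𝓘(ℝ, E) (extChartAt 𝓘(ℝ, E) x₀).symm
      (extChartAt 𝓘(ℝ, E) x₀ x) u := by
  change (trivializationAt E (TangentSpace 𝓘(ℝ, E) : M → Type _) x₀).symmL ℝ x u = _
  rw [TangentBundle.symmL_trivializationAt hx, ModelWithCorners.range_eq_univ, mfderivWithin_univ]
  rfl

theorem differentiableAt_transition {x₀ x : M} (hx : x ∈ (chartAt E x₀).source) :
    DifferentiableAt ℂ (chartAt E x ∘ (chartAt E x₀).symm) (chartAt E x₀ x) := by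
  have h := (contDiffGroupoid ω 𝓘(ℂ, E)).compatible (chart_mem_atlas E x₀) (chart_mem_atlas E x)
  rw [contDiffGroupoid, mem_groupoid_of_pregroupoid] at h
  have h1 : ContDiffOn ℂ ω (chartAt E x ∘ (chartAt E x₀).symm)
      (((chartAt E x₀).symm.trans (chartAt E x)).source ∩ Set.range (id : E → E)) := h.1
  rw [Set.range_id, Set.inter_univ] at h1
  have hmem : chartAt E x₀ x ∈ ((chartAt E x₀).symm.trans (chartAt E x)).source := by
    simp [hx]
  exact (h1.contDiffAt (((chartAt E x₀).symm.trans (chartAt E x)).open_source.mem_nhds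
    hmem)).differentiableAt (by simp)

theorem coordField_eq_fderiv {x₀ x : M} (hx : x ∈ (chartAt E x₀).source) (w : E) :
    (coordField x₀ w x : E) = fderiv ℂ
      (chartAt E x ∘ (chartAt E x₀).symm) (chartAt E x₀ x) w := by
  have h := TangentBundle.symmL_trivializationAt_eq_core (I := 𝓘(ℝ, E)) hx
  change (trivializationAt E (TangentSpace 𝓘(ℝ, E) : M → Type _) x₀).symmL ℝ x w = _
  rw [h, tangentBundleCore_coordChange_achart, ModelWithCorners.range_eq_univ, fderivWithin_univ]
  change fderiv ℝ (chartAt E x ∘ (chartAt E x₀).symm) (chartAt E x₀ x) w = _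
  rw [(differentiableAt_transition hx).fderiv_restrictScalars ℝ]
  rfl

/-- J at x is multiplication by i in the chart preferred at x, not at x₀; the two agree because the
transition derivative is complex linear. -/
theorem complexStructure_coordField {x₀ x : M} (hx : x ∈ (chartAt E x₀).source) (u : E) :
    complexStructure x (coordField x₀ u x) = coordField x₀ (Complex.I • u) x := by
  have h1 : (coordField x₀ (Complex.I • u) x : E) =
      (Complex.I • (show E from coordField x₀ u x) : E) := by
    rw [coordField_eq_fderiv hx, coordField_eq_fderiv hx, map_smul]
  exact h1.symm

theorem contMDiffAt_coordField {x₀ x : M} (hx : x ∈ (chartAt E x₀).source) (u : E) :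
    ContMDiffAt 𝓘(ℝ, E) (𝓘(ℝ, E).prod 𝓘(ℝ, E)) ∞
    (fun y => (⟨y, coordField x₀ u y⟩ : TotalSpace E (TangentSpace 𝓘(ℝ, E) : M → Type _))) x := by
  set t := trivializationAt E (TangentSpace 𝓘(ℝ, E) : M → Type _) x₀ with ht
  have hx' : x ∈ t.baseSet := hx
  refine (t.contMDiffAt_section_iff hx').mpr ?_
  have : ContMDiffAt 𝓘(ℝ, E) 𝓘(ℝ, E) ∞ (fun _ : M => u) x := contMDiffAt_const
  refine this.congr_of_eventuallyEq ?_
  filter_upwards [t.open_baseSet.mem_nhds hx'] with y hy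
  change (t ⟨y, t.symmL ℝ y u⟩).2 = u
  have := t.apply_mk_symm hy u
  rw [Bundle.Trivialization.symmL_apply _ hy, this]

theorem inverse_mfderiv_extChartAt {x₀ x : M} (hx : x ∈ (chartAt E x₀).source) (u : E) :
    (mfderiv 𝓘(ℝ, E) 𝓘(ℝ, E) (extChartAt 𝓘(ℝ, E) x₀) x).inverse u = coordField x₀ u x := by
  have hx' : x ∈ (extChartAt 𝓘(ℝ, E) x₀).source := by rwa [extChartAt_source]
  have h1 := mfderivWithin_extChartAt_symm_comp_mfderiv_extChartAt' hx'
  have h2 := mfderiv_extChartAt_comp_mfderivWithin_extChartAt_symm' hx'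
  rw [coordField_eq_mfderiv hx]
  rw [ModelWithCorners.range_eq_univ, mfderivWithin_univ] at h1 h2
  rw [ContinuousLinearMap.inverse_eq h2 h1]
  rfl

theorem mlieBracket_coordField [CompleteSpace E] {x₀ x : M} (hx : x ∈ (chartAt E x₀).source)
    (u w : E) :
    VectorField.mlieBracket 𝓘(ℝ, E) (coordField x₀ u) (coordField x₀ w) x = 0 := by
  let c : E → (y : E) → TangentSpace 𝓘(ℝ, E) y := fun u _ => u
  have hpull : ∀ u : E, coordField x₀ u =ᶠ[𝓝 x] VectorField.mpullback 𝓘(ℝ, E) 𝓘(ℝ, E)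
      (extChartAt 𝓘(ℝ, E) x₀) (c u) := by
    intro u
    filter_upwards [(chartAt E x₀).open_source.mem_nhds hx] with y hy
    exact (inverse_mfderiv_extChartAt hy u).symm
  rw [(hpull u).mlieBracket_vectorField_eq (hpull w)]
  have hV : ∀ u : E, MDifferentiableAt 𝓘(ℝ, E) (𝓘(ℝ, E).prod 𝓘(ℝ, E))
    (fun y : E => (⟨y, c u y⟩ : TotalSpace E (TangentSpace 𝓘(ℝ, E) : E → Type _)))
      (extChartAt 𝓘(ℝ, E) x₀ x) := fun u =>
    (contMDiffAt_vectorSpace_iff_contDiffAt (n := 1) (V := c u) |>.mpr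
      contDiffAt_const).mdifferentiableAt one_ne_zero
  have hbr : VectorField.mlieBracket 𝓘(ℝ, E) (c u) (c w) = 0 := by
    rw [← VectorField.mlieBracketWithin_univ, VectorField.mlieBracketWithin_eq_lieBracketWithin,
      VectorField.lieBracketWithin_univ]
    ext y
    change fderiv ℝ (fun _ : E => w) y u - fderiv ℝ (fun _ : E => u) y w = (0 : E)
    simp
  rw [← VectorField.mpullback_mlieBracket (n := ω) (hV u) (hV w) (contMDiffAt_extChartAt' hx)
    le_top, hbr]
  exact ContinuousLinearMap.map_zero _

end CoordinateFields

/-! ### Global extensions of coordinate fields by bump functions. -/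

section Fields

open scoped Topology

attribute [local instance] completeSpaceModel

variable {E : Type*} [NormedAddCommGroup E] [NormedSpace ℂ E] [FiniteDimensional ℂ E]
  {M : Type*} [TopologicalSpace M] [ChartedSpace E M]

/-- A smooth bump function at `x₀`. -/
def bump (x₀ : M) : SmoothBumpFunction 𝓘(ℝ, E) x₀ := Classical.arbitrary _

variable [IsManifold 𝓘(ℂ, E) ω M]

/-- A globally defined vector field which agrees with a coordinate field near `x₀`. -/
def bumpField (x₀ : M) (u : E) : VField E M := fun x => bump (E := E) x₀ x • coordField x₀ u x

theorem bumpField_eventuallyEq (x₀ : M) (u : E) : bumpField x₀ u =ᶠ[𝓝 x₀] coordField x₀ u := by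
  filter_upwards [(bump (E := E) x₀).eventuallyEq_one] with x hx
  simp only [bumpField]
  rw [hx, Pi.one_apply, one_smul]

theorem bumpField_self (x₀ : M) (u : E) : bumpField x₀ u x₀ = u := by
  rw [(bumpField_eventuallyEq x₀ u).eq_of_nhds, coordField_self]

theorem isSmoothField_bumpField [T2Space M] (x₀ : M) (u : E) :
    IsSmoothField (bumpField x₀ u) := by
  intro x
  by_cases hx : x ∈ (chartAt E x₀).source
  · exact ((bump (E := E) x₀).contMDiff x).smul_section (contMDiffAt_coordField hx u)
  · have h0 : (bump (E := E) x₀ : M → ℝ) =ᶠ[𝓝 x] 0 := by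
      refine notMem_tsupport_iff_eventuallyEq.mp fun h => hx ?_
      exact (bump (E := E) x₀).tsupport_subset_chartAt_source h
    refine (contMDiffAt_zeroSection (n := ∞) (IB := 𝓘(ℝ, E)) ℝ
      (TangentSpace 𝓘(ℝ, E) : M → Type _) (x := x) (F := E)).congr_of_eventuallyEq ?_
    filter_upwards [h0] with y hy
    simp only [bumpField]
    rw [hy, Pi.zero_apply, zero_smul]
    rfl

/-- This holds globally: outside the chart domain the bump function vanishes. -/
theorem complexStructureField_bumpField (x₀ : M) (u : E) :
    complexStructureField (bumpField x₀ u) = bumpField x₀ (Complex.I • u) := by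
  funext x
  simp only [complexStructureField, bumpField, map_smul]
  by_cases hx : x ∈ (chartAt E x₀).source
  · rw [complexStructure_coordField hx]
  · have h0 : bump (E := E) x₀ x = 0 := by
      by_contra h
      exact hx ((bump (E := E) x₀).support_subset_source h)
    rw [h0, zero_smul, zero_smul]

theorem bumpField_add (x₀ : M) (u w : E) :
    bumpField x₀ (u + w) = bumpField x₀ u + bumpField x₀ w := by
  funext x
  simp [bumpField, coordField]

theorem bumpField_smul (x₀ : M) (c : ℝ) (u : E) :
    bumpField x₀ (c • u) = c • bumpField x₀ u := by
  funext x
  simp only [bumpField, coordField, map_smul, Pi.smul_apply]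
  rw [smul_comm]

theorem mlieBracket_bumpField (x₀ : M) (u w : E) : ∀ᶠ x in 𝓝 x₀,
    VectorField.mlieBracket 𝓘(ℝ, E) (bumpField x₀ u) (bumpField x₀ w) x = 0 := by
  filter_upwards [(bumpField_eventuallyEq x₀ u).eventuallyEq_nhds,
    (bumpField_eventuallyEq x₀ w).eventuallyEq_nhds,
    (chartAt E x₀).open_source.mem_nhds (mem_chart_source E x₀)] with x hu hw hx
  rw [hu.mlieBracket_vectorField_eq hw, mlieBracket_coordField hx]

end Fields

/-! ### Torsion and curvature on commuting fields. -/

section ConnectionCalculus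

open scoped Topology

attribute [local instance] completeSpaceModel

variable {E : Type*} [NormedAddCommGroup E] [NormedSpace ℂ E]
  {M : Type*} [TopologicalSpace M] [ChartedSpace E M] [IsManifold 𝓘(ℂ, E) ω M]

theorem IsSmoothField.diffAt {X : VField E M} (hX : IsSmoothField X) (x : M) : DiffAt X x :=
  (hX x).mdifferentiableAt (by simp)

theorem isSmoothField_connection {D : Connection E M}
    (hD : CovariantDerivative.ContMDiffCovariantDerivative D ∞) {X Y : VField E M}
    (hX : IsSmoothField X) (hY : IsSmoothField Y) : IsSmoothField (fun x => D Y x (X x)) := by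
  have h := hD.contMDiff.contMDiff (σ := Y) (hY.contMDiffOn)
  intro x
  exact ContMDiffAt.clm_bundle_apply (h.contMDiffAt Filter.univ_mem) (hX x)

theorem connection_congr (D : Connection E M) {X Y : VField E M} {x : M} (hX : DiffAt X x)
    (hXY : X =ᶠ[𝓝 x] Y) : D X x = D Y x := by
  refine D.isCovariantDerivativeOnUniv.congr_of_eventuallyEq hX ?_ Filter.univ_mem hXY
  refine hX.congr_of_eventuallyEq ?_
  filter_upwards [hXY] with y hy
  rw [hy]

theorem connection_sub (D : Connection E M) {X Y : VField E M} {x : M} (hX : DiffAt X x)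
    (hY : DiffAt Y x) : D (X - Y) x = D X x - D Y x := by
  have h1 : DiffAt ((-1 : ℝ) • Y) x := MDifferentiableAt.smul_const_section hY
  rw [sub_eq_add_neg, ← neg_one_smul ℝ Y, D.isCovariantDerivativeOnUniv.add hX h1,
    D.isCovariantDerivativeOnUniv.smul_const _ hY, neg_one_smul, ← sub_eq_add_neg]

variable [FiniteDimensional ℂ E]

theorem torsion_field (D : Connection E M) {X Y : VField E M} {x : M} (hX : DiffAt X x)
    (hY : DiffAt Y x) : torsion D x (X x) (Y x) =
      D Y x (X x) - D X x (Y x) - VectorField.mlieBracket 𝓘(ℝ, E) X Y x :=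
  CovariantDerivative.torsion_apply D hX hY

theorem torsion_skew (D : Connection E M) (x : M) (u v : TangentSpace 𝓘(ℝ, E) x) :
    torsion D x u v = - torsion D x v u :=
  CovariantDerivative.torsion_antisymm D u v

variable [T2Space M]

theorem torsion_bumpField_eventuallyEq (D : Connection E M) (x₀ : M) (u w : E) :
    (fun x => torsion D x (bumpField x₀ u x) (bumpField x₀ w x)) =ᶠ[𝓝 x₀]
    (fun x => D (bumpField x₀ w) x (bumpField x₀ u x)) -
      (fun x => D (bumpField x₀ u) x (bumpField x₀ w x)) := by
  filter_upwards [mlieBracket_bumpField x₀ u w] with x hx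
  rw [torsion_field D ((isSmoothField_bumpField x₀ u).diffAt x)
    ((isSmoothField_bumpField x₀ w).diffAt x), hx, sub_zero]
  rfl

theorem diffAt_torsion_bumpField {D : Connection E M}
    (hD : CovariantDerivative.ContMDiffCovariantDerivative D ∞) (x₀ : M) (u w : E) :
    DiffAt (fun x => torsion D x (bumpField x₀ u x) (bumpField x₀ w x)) x₀ := by
  have h1 := (isSmoothField_connection hD (isSmoothField_bumpField x₀ u)
    (isSmoothField_bumpField x₀ w)).diffAt x₀
  have h2 := (isSmoothField_connection hD (isSmoothField_bumpField x₀ w)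
    (isSmoothField_bumpField x₀ u)).diffAt x₀
  have h := mdifferentiableAt_sub_section h1 h2
  refine MDifferentiableAt.congr_of_eventuallyEq h ?_
  filter_upwards [torsion_bumpField_eventuallyEq D x₀ u w] with y hy
  rw [hy]

/-- The first Bianchi identity for coordinate fields. -/
theorem cyclic_curvature_bumpField {D : Connection E M}
    (hD : CovariantDerivative.ContMDiffCovariantDerivative D ∞) (x₀ : M) (x y z : E) :
    curvature D (bumpField x₀ x) (bumpField x₀ y) (bumpField x₀ z) x₀ +
    curvature D (bumpField x₀ y) (bumpField x₀ z) (bumpField x₀ x) x₀ +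
    curvature D (bumpField x₀ z) (bumpField x₀ x) (bumpField x₀ y) x₀ =
    D (fun p => torsion D p (bumpField x₀ y p) (bumpField x₀ z p)) x₀ (bumpField x₀ x x₀) +
    D (fun p => torsion D p (bumpField x₀ z p) (bumpField x₀ x p)) x₀ (bumpField x₀ y x₀) +
    D (fun p => torsion D p (bumpField x₀ x p) (bumpField x₀ y p)) x₀ (bumpField x₀ z x₀) := by
  have h : ∀ y z : E, D (fun p => torsion D p (bumpField x₀ y p) (bumpField x₀ z p)) x₀ =
      D (fun p => D (bumpField x₀ z) p (bumpField x₀ y p)) x₀ -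
      D (fun p => D (bumpField x₀ y) p (bumpField x₀ z p)) x₀ := by
    intro y z
    rw [connection_congr D (diffAt_torsion_bumpField hD x₀ y z)
      (torsion_bumpField_eventuallyEq D x₀ y z), connection_sub]
    · exact (isSmoothField_connection hD (isSmoothField_bumpField x₀ y)
        (isSmoothField_bumpField x₀ z)).diffAt x₀
    · exact (isSmoothField_connection hD (isSmoothField_bumpField x₀ z)
        (isSmoothField_bumpField x₀ y)).diffAt x₀
  have hb : ∀ y z : E, VectorField.mlieBracket 𝓘(ℝ, E) (bumpField x₀ y) (bumpField x₀ z) x₀ = 0 :=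
    fun y z => (mlieBracket_bumpField x₀ y z).self_of_nhds
  simp only [curvature, h, hb, map_zero, sub_zero, sub_apply]
  abel

end ConnectionCalculus

/-! ### Transfer of the algebra to a positive definite form. -/

section BilinearForms

variable {V : Type*} [AddCommGroup V] [Module ℝ V] {T : V →ₗ[ℝ] V →ₗ[ℝ] V} {J : V →ₗ[ℝ] V}

/-- The inner product space structure given by a positive definite bilinear form. -/
abbrev innerProductCore (B : V →ₗ[ℝ] V →ₗ[ℝ] ℝ) (hB : ∀ x y, B x y = B y x)
    (hpos : ∀ x, x ≠ 0 → 0 < B x x) : InnerProductSpace.Core ℝ V where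
  inner x y := B x y
  conj_inner_symm x y := hB y x
  re_inner_nonneg x := by
    rcases eq_or_ne x 0 with rfl | hx
    · simp
    · simpa using (hpos x hx).le
  add_left x y z := by simp
  smul_left x y r := by simp
  definite x h := by
    contrapose! h
    exact (hpos x h).ne'

/-- The tangent space has the fixed norm of the model space, so the inner product of g is installed
only inside the proof. -/
theorem stromingerTorsion_eq_of_form {B : V →ₗ[ℝ] V →ₗ[ℝ] ℝ} (hB : ∀ x y, B x y = B y x)
    (hpos : ∀ x, x ≠ 0 → 0 < B x x) {S : V →ₗ[ℝ] V →ₗ[ℝ] V} {Γ : V → V → V}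
    (hJJ : ∀ x, J (J x) = -x) (hJ : ∀ x y, B (J x) (J y) = B x y) (hT : ∀ x y, T x y = - T y x)
    (hTJ : ∀ x y, T (J x) y = J (T x y)) (hΓ : ∀ x y z, B (Γ x y) z = - B y (Γ x z))
    (hΓJ : ∀ x y, Γ x (J y) = J (Γ x y)) (hST : ∀ x y, S x y = T x y + Γ x y - Γ y x)
    (hS : ∀ x y z, B (S x y) z = - B (S x z) y) (x y z : V) :
    B (S x y) z = - (B (T x y) z + B (T y z) x + B (T z x) y) := by
  let core := innerProductCore B hB hpos
  let : NormedAddCommGroup V := core.toNormedAddCommGroup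
  let : InnerProductSpace ℝ V := InnerProductSpace.ofCore core.toCore
  exact stromingerTorsion_eq hJJ hJ hT hTJ hΓ hΓJ hST hS x y z

theorem trace_flip_eq_zero_of_bianchi_of_form [FiniteDimensional ℝ V] {B : V →ₗ[ℝ] V →ₗ[ℝ] ℝ}
    (hsymm : ∀ x y, B x y = B y x) (hpos : ∀ x, x ≠ 0 → 0 < B x x)
    {τ Γ : V → V → V} {dt : V → V → V → V → ℝ}
    (hJJ : ∀ x, J (J x) = -x) (hJ : ∀ x y, B (J x) (J y) = B x y) (hT : ∀ x y, T x y = - T y x)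
    (hTJ : ∀ x y, T (J x) y = J (T x y))
    (hτ : ∀ x y z, B (τ x y) z = -(1 / 2) * (B (T y z) x + B (T z x) y))
    (hΓJ : ∀ x y, Γ x (J y) = J (Γ x y)) (hΓ : ∀ x y, Γ x y - Γ y x = τ x y)
    (hdt : ∀ x y z w, dt x y z w = - dt x z y w)
    (hdtJ : ∀ x y z w, dt x (J y) (J z) w = - dt x y z w)
    (hdtJ' : ∀ x y z w, dt x (J y) z (J w) = dt x y z w)
    (hB : ∀ x y z w,
      (-(1 / 2) * (dt x z w y + dt x w y z) - B (τ y z) (Γ x w)) +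
      (-(1 / 2) * (dt y x w z + dt y w z x) - B (τ z x) (Γ y w)) +
      (-(1 / 2) * (dt z y w x + dt z w x y) - B (τ x y) (Γ z w)) = 0) (v : V) :
    LinearMap.trace ℝ V (T.flip v) = 0 := by
  let core := innerProductCore B hsymm hpos
  let : NormedAddCommGroup V := core.toNormedAddCommGroup
  let : InnerProductSpace ℝ V := InnerProductSpace.ofCore core.toCore
  exact trace_flip_eq_zero_of_bianchi hJJ hJ hT hTJ hτ hΓJ hΓ hdt hdtJ hdtJ' hB v

end BilinearForms

/-! ### Christoffel symbols and the torsion of the Lichnerowicz connection. -/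

section PointwiseIdentities

open scoped Topology

attribute [local instance] completeSpaceModel

variable {E : Type*} [NormedAddCommGroup E] [NormedSpace ℂ E]
  {M : Type*} [TopologicalSpace M] [ChartedSpace E M]

/-- The derivative of a real function in the direction of a tangent vector. -/
def dirDeriv (f : M → ℝ) (x : M) (v : TangentSpace 𝓘(ℝ, E) x) : ℝ :=
  mfderiv 𝓘(ℝ, E) 𝓘(ℝ, ℝ) f x v

theorem dirDeriv_neg (f : M → ℝ) (x : M) (v : TangentSpace 𝓘(ℝ, E) x) :
    dirDeriv (fun y => -f y) x v = -dirDeriv f x v := by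
  have h := mfderiv_neg (I := 𝓘(ℝ, E)) (f := f) (x := x)
  exact DFunLike.congr_fun h v

theorem dirDeriv_mul_add {f f' : M → ℝ} {x : M} (hf : MDifferentiableAt 𝓘(ℝ, E) 𝓘(ℝ, ℝ) f x)
    (hf' : MDifferentiableAt 𝓘(ℝ, E) 𝓘(ℝ, ℝ) f' x) (c : ℝ) (v : TangentSpace 𝓘(ℝ, E) x) :
    dirDeriv (fun y => c * (f y + f' y)) x v = c * (dirDeriv f x v + dirDeriv f' x v) := by
  have h := ((hf.hasMFDerivAt.add hf'.hasMFDerivAt).const_smul c).mfderiv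
  exact DFunLike.congr_fun h v

theorem complexStructure_complexStructure (x : M) (u : TangentSpace 𝓘(ℝ, E) x) :
    complexStructure x (complexStructure x u) = -u := by
  change (Complex.I • (Complex.I • (show E from u)) : E) = -(show E from u)
  rw [smul_smul, Complex.I_mul_I, neg_one_smul]

variable [IsManifold 𝓘(ℂ, E) ω M]

/-- The metric as a bilinear form on a tangent space. -/
def metricForm (g : HermitianMetric E M) (x : M) :
    TangentSpace 𝓘(ℝ, E) x →ₗ[ℝ] TangentSpace 𝓘(ℝ, E) x →ₗ[ℝ] ℝ :=
  LinearMap.mk₂ ℝ (fun u v => g.inner x u v) (by simp) (by simp) (by simp) (by simp)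

theorem mdifferentiableAt_metric (g : HermitianMetric E M) {Y Z : VField E M} {x : M}
    (hY : DiffAt Y x) (hZ : DiffAt Z x) :
    MDifferentiableAt 𝓘(ℝ, E) 𝓘(ℝ, ℝ) (fun y => g.inner y (Y y) (Z y)) x := by
  have : MDifferentiableAt 𝓘(ℝ, E) (𝓘(ℝ, E).prod 𝓘(ℝ, ℝ))
      (fun m ↦ TotalSpace.mk' ℝ (E := Bundle.Trivial M ℝ) m (g.inner m (Y m) (Z m))) x := by
    apply MDifferentiableAt.clm_bundle_apply₂ (F₁ := E) (F₂ := E)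
    · exact g.contMDiff.mdifferentiableAt (by simp)
    · exact hY
    · exact hZ
  simp only [mdifferentiableAt_totalSpace] at this
  exact this.2

theorem lichnerowiczConnection_apply (c s : Connection E M) (Y : VField E M) (x : M)
    (v : TangentSpace 𝓘(ℝ, E) x) :
    lichnerowiczConnection c s Y x v = (1 / 2 : ℝ) • c Y x v + (1 / 2 : ℝ) • s Y x v := by
  change ((1 + 0) / 2 : ℝ) • c Y x v + (1 - (1 + 0) / 2 : ℝ) • s Y x v = _
  norm_num

theorem isHermitianConnection_lichnerowicz {g : HermitianMetric E M} {c s : Connection E M}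
    (hc : IsHermitianConnection g c) (hs : IsHermitianConnection g s) :
    IsHermitianConnection g (lichnerowiczConnection c s) where
  smooth := CovariantDerivative.ContMDiffCovariantDerivative.affineCombination c s
    contMDiff_const hc.smooth hs.smooth
  metric x Y Z hY hZ v := by
    have h1 := hc.metric x Y Z hY hZ v
    have h2 := hs.metric x Y Z hY hZ v
    simp only [lichnerowiczConnection_apply, map_add, map_smul, add_apply, smul_apply, smul_eq_mul]
    have h : ∀ m a b a' b' : ℝ, m = a + b → m = a' + b' →
        m = (1 / 2 * a + 1 / 2 * a') + (1 / 2 * b + 1 / 2 * b') := by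
      intros
      linarith
    exact h _ _ _ _ _ h1 h2
  complex x Y hY v := by
    simp only [lichnerowiczConnection_apply, hc.complex x Y hY v, hs.complex x Y hY v, map_add,
      map_smul]

variable [FiniteDimensional ℂ E]

/-- A globally defined smooth vector field with a given value at `x`. -/
def tangentField (x : M) (u : TangentSpace 𝓘(ℝ, E) x) : VField E M := bumpField (E := E) x u

theorem tangentField_self (x : M) (u : TangentSpace 𝓘(ℝ, E) x) : tangentField x u x = u :=
  bumpField_self (E := E) x u

theorem complexStructureField_tangentField (x : M) (u : TangentSpace 𝓘(ℝ, E) x) :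
    complexStructureField (tangentField x u) = tangentField x (complexStructure x u) :=
  complexStructureField_bumpField (E := E) x u

theorem mlieBracket_tangentField (x : M) (u v : TangentSpace 𝓘(ℝ, E) x) :
    VectorField.mlieBracket 𝓘(ℝ, E) (tangentField x u) (tangentField x v) x = 0 :=
  (mlieBracket_bumpField (E := E) x u v).self_of_nhds

/-- The torsion as a bilinear map. -/
def torsionMap (D : Connection E M) (x : M) : TangentSpace 𝓘(ℝ, E) x →ₗ[ℝ]
    TangentSpace 𝓘(ℝ, E) x →ₗ[ℝ] TangentSpace 𝓘(ℝ, E) x :=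
  LinearMap.mk₂ ℝ (torsion D x) (by simp [torsion]) (by simp [torsion]) (by simp [torsion])
    (by simp [torsion])

/-- The Christoffel symbols of a connection at the centre of a chart. -/
def christoffel (D : Connection E M) (x : M) (u v : TangentSpace 𝓘(ℝ, E) x) :
    TangentSpace 𝓘(ℝ, E) x := D (tangentField x v) x u

variable [T2Space M]

theorem diffAt_tangentField (x : M) (u : TangentSpace 𝓘(ℝ, E) x) (y : M) :
    DiffAt (tangentField x u) y :=
  (isSmoothField_bumpField (E := E) x u).diffAt y

theorem christoffel_sub_christoffel (D : Connection E M) (x : M) (u v : TangentSpace 𝓘(ℝ, E) x) :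
    christoffel D x u v - christoffel D x v u = torsion D x u v := by
  have h := torsion_field D (diffAt_tangentField x u x) (diffAt_tangentField x v x)
  rw [mlieBracket_tangentField, sub_zero, tangentField_self, tangentField_self] at h
  exact h.symm

theorem christoffel_complexStructure {D : Connection E M} (hD : IsComplex D) (x : M)
    (u v : TangentSpace 𝓘(ℝ, E) x) :
    christoffel D x u (complexStructure x v) = complexStructure x (christoffel D x u v) := by
  have h := hD x (tangentField x v) (diffAt_tangentField x v x) u
  rw [complexStructureField_tangentField] at h
  exact h

theorem dirDeriv_metric_tangentField {g : HermitianMetric E M} {D : Connection E M}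
    (hD : IsMetric g D) (x : M) (u v w : TangentSpace 𝓘(ℝ, E) x) :
    dirDeriv (fun y => g.inner y (tangentField x v y) (tangentField x w y)) x u =
      g.inner x (christoffel D x u v) w + g.inner x v (christoffel D x u w) := by
  have h := hD x _ _ (diffAt_tangentField x v x) (diffAt_tangentField x w x) u
  rw [tangentField_self, tangentField_self] at h
  exact h

theorem torsion_lichnerowicz (c s : Connection E M) (x : M) (u v : TangentSpace 𝓘(ℝ, E) x) :
    torsion (lichnerowiczConnection c s) x u v =
      (1 / 2 : ℝ) • (torsion c x u v + torsion s x u v) := by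
  simp only [← christoffel_sub_christoffel, christoffel, lichnerowiczConnection_apply]
  module

/-- Averaging T with minus its cyclic sum cancels the term g(T(u, v), w). -/
theorem inner_torsion_lichnerowicz {g : HermitianMetric E M} {c s : Connection E M}
    (hc : IsChernConnection g c) (hs : IsStromingerConnection g s) (x : M)
    (u v w : TangentSpace 𝓘(ℝ, E) x) :
    g.inner x (torsion (lichnerowiczConnection c s) x u v) w =
      -(1 / 2) * (g.inner x (torsion c x v w) u + g.inner x (torsion c x w u) v) := by
  have h := stromingerTorsion_eq_of_form (B := metricForm g x) (T := torsionMap c x)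
    (S := torsionMap s x) (J := (complexStructure x).toLinearMap)
    (Γ := fun u v => christoffel s x u v - christoffel c x u v) (g.symm x) (g.pos x)
    (complexStructure_complexStructure x) (g.invariant x) (torsion_skew c x) (hc.torsion_type x)
    ?_ ?_ ?_ (hs.torsion_skew x) u v w
  · have h' : g.inner x (torsion s x u v) w = -(g.inner x (torsion c x u v) w +
      g.inner x (torsion c x v w) u + g.inner x (torsion c x w u) v) := h
    rw [torsion_lichnerowicz, map_smul, map_add, smul_apply, add_apply, h', smul_eq_mul]
    ring
  · intro u v w
    change g.inner x (christoffel s x u v - christoffel c x u v) w =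
      -g.inner x v (christoffel s x u w - christoffel c x u w)
    have h1 := dirDeriv_metric_tangentField hc.metric x u v w
    have h2 := dirDeriv_metric_tangentField hs.metric x u v w
    rw [map_sub, map_sub, sub_apply]
    linarith
  · intro u v
    change christoffel s x u (complexStructure x v) - christoffel c x u (complexStructure x v) =
      complexStructure x (christoffel s x u v - christoffel c x u v)
    rw [christoffel_complexStructure hs.complex, christoffel_complexStructure hc.complex, map_sub]
  · intro u v
    change torsion s x u v = torsion c x u v + (christoffel s x u v - christoffel c x u v) -
      (christoffel s x v u - christoffel c x v u)
    rw [← christoffel_sub_christoffel, ← christoffel_sub_christoffel]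
    abel

end PointwiseIdentities

/-! ### Vanishing of the torsion 1-form. -/

section TorsionOneForm

open scoped Topology

attribute [local instance] completeSpaceModel

variable {E : Type*} [NormedAddCommGroup E] [NormedSpace ℂ E] [FiniteDimensional ℂ E]
  {M : Type*} [TopologicalSpace M] [ChartedSpace E M] [IsManifold 𝓘(ℂ, E) ω M]

/-- The coefficients `g(T(∂_y, ∂_z), ∂_w)` of the torsion in the coordinates at `x`. -/
def torsionCoeff (g : HermitianMetric E M) (D : Connection E M) (x : M)
    (y z w : TangentSpace 𝓘(ℝ, E) x) (p : M) : ℝ :=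
  g.inner p (torsion D p (tangentField x y p) (tangentField x z p)) (tangentField x w p)

theorem tangentField_complexStructure (x : M) (u : TangentSpace 𝓘(ℝ, E) x) (p : M) :
    tangentField x (complexStructure x u) p = complexStructure p (tangentField x u p) := by
  rw [← complexStructureField_tangentField]
  rfl

theorem IsChernConnection.torsion_type_right {g : HermitianMetric E M} {c : Connection E M}
    (hc : IsChernConnection g c) (x : M) (u v : TangentSpace 𝓘(ℝ, E) x) :
    torsion c x u (complexStructure x v) = complexStructure x (torsion c x u v) := by
  rw [torsion_skew, hc.torsion_type, ← map_neg, ← torsion_skew]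

theorem IsChernConnection.torsion_complexStructure {g : HermitianMetric E M} {c : Connection E M}
    (hc : IsChernConnection g c) (x : M) (u v : TangentSpace 𝓘(ℝ, E) x) :
    torsion c x (complexStructure x u) (complexStructure x v) = -torsion c x u v := by
  rw [hc.torsion_type, hc.torsion_type_right, complexStructure_complexStructure]

variable [T2Space M]

theorem diffAt_torsion_tangentField {D : Connection E M}
    (hD : CovariantDerivative.ContMDiffCovariantDerivative D ∞) (x : M)
    (u w : TangentSpace 𝓘(ℝ, E) x) :
    DiffAt (fun p => torsion D p (tangentField x u p) (tangentField x w p)) x :=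
  diffAt_torsion_bumpField (E := E) hD x u w

theorem cyclic_curvature_tangentField {D : Connection E M}
    (hD : CovariantDerivative.ContMDiffCovariantDerivative D ∞) (x₀ : M)
    (x y z : TangentSpace 𝓘(ℝ, E) x₀) :
    curvature D (tangentField x₀ x) (tangentField x₀ y) (tangentField x₀ z) x₀ +
    curvature D (tangentField x₀ y) (tangentField x₀ z) (tangentField x₀ x) x₀ +
    curvature D (tangentField x₀ z) (tangentField x₀ x) (tangentField x₀ y) x₀ =
    D (fun p => torsion D p (tangentField x₀ y p) (tangentField x₀ z p)) x₀ x +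
    D (fun p => torsion D p (tangentField x₀ z p) (tangentField x₀ x p)) x₀ y +
    D (fun p => torsion D p (tangentField x₀ x p) (tangentField x₀ y p)) x₀ z := by
  refine (cyclic_curvature_bumpField (E := E) hD x₀ x y z).trans ?_
  change D _ x₀ (tangentField x₀ x x₀) + D _ x₀ (tangentField x₀ y x₀) +
    D _ x₀ (tangentField x₀ z x₀) = _
  rw [tangentField_self, tangentField_self, tangentField_self]
  rfl

theorem mdifferentiableAt_torsionCoeff (g : HermitianMetric E M) {D : Connection E M}
    (hD : CovariantDerivative.ContMDiffCovariantDerivative D ∞) (x : M)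
    (y z w : TangentSpace 𝓘(ℝ, E) x) :
    MDifferentiableAt 𝓘(ℝ, E) 𝓘(ℝ, ℝ) (torsionCoeff g D x y z w) x :=
  mdifferentiableAt_metric g (diffAt_torsion_tangentField hD x y z) (diffAt_tangentField x w x)

/-- The trace of the Chern torsion vanishes when the Lichnerowicz connection is Kähler-like. -/
theorem trace_flip_torsion_eq_zero {g : HermitianMetric E M} {c s : Connection E M}
    (hc : IsChernConnection g c) (hs : IsStromingerConnection g s)
    (hKL : IsKahlerLike g (lichnerowiczConnection c s)) (x : M) (v : TangentSpace 𝓘(ℝ, E) x) :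
    LinearMap.trace ℝ (TangentSpace 𝓘(ℝ, E) x) ((torsionMap c x).flip v) = 0 := by
  have hD := isHermitianConnection_lichnerowicz hc.toIsHermitianConnection
    hs.toIsHermitianConnection
  have hfin : FiniteDimensional ℝ (TangentSpace 𝓘(ℝ, E) x) :=
    inferInstanceAs (FiniteDimensional ℝ E)
  set D := lichnerowiczConnection c s with hDdef
  refine trace_flip_eq_zero_of_bianchi_of_form (B := metricForm g x) (T := torsionMap c x)
    (J := (complexStructure x).toLinearMap) (τ := torsion D x) (Γ := christoffel D x)
    (dt := fun u y z w => dirDeriv (torsionCoeff g c x y z w) x u) (g.symm x) (g.pos x)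
    (complexStructure_complexStructure x) (g.invariant x) (torsion_skew c x) (hc.torsion_type x)
    (inner_torsion_lichnerowicz hc hs x) (christoffel_complexStructure hD.complex x)
    (christoffel_sub_christoffel D x) ?_ ?_ ?_ ?_ v
  · intro u y z w
    rw [← dirDeriv_neg]
    congr 1
    funext p
    rw [torsionCoeff, torsion_skew, map_neg]
    rfl
  · intro u y z w
    rw [← dirDeriv_neg]
    congr 1
    funext p
    change g.inner p (torsion c p (tangentField x (complexStructure x y) p)
      (tangentField x (complexStructure x z) p)) (tangentField x w p) = _
    rw [tangentField_complexStructure, tangentField_complexStructure, hc.torsion_type,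
      hc.torsion_type_right, complexStructure_complexStructure, map_neg]
    rfl
  · intro u y z w
    congr 1
    funext p
    change g.inner p (torsion c p (tangentField x (complexStructure x y) p)
      (tangentField x z p)) (tangentField x (complexStructure x w) p) = _
    rw [tangentField_complexStructure, tangentField_complexStructure, hc.torsion_type,
      g.invariant]
    rfl
  · have hmetric : ∀ u y z w : TangentSpace 𝓘(ℝ, E) x,
        g.inner x (D (fun p => torsion D p (tangentField x y p) (tangentField x z p)) x u) w =
          -(1 / 2) * (dirDeriv (torsionCoeff g c x z w y) x u +
            dirDeriv (torsionCoeff g c x w y z) x u) -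
          g.inner x (torsion D x y z) (christoffel D x u w) := by
      intro u y z w
      have h := hD.metric x _ _ (diffAt_torsion_tangentField hD.smooth x y z)
        (diffAt_tangentField x w x) u
      have h' : dirDeriv (fun p => g.inner p (torsion D p (tangentField x y p)
          (tangentField x z p)) (tangentField x w p)) x u =
          -(1 / 2) * (dirDeriv (torsionCoeff g c x z w y) x u +
            dirDeriv (torsionCoeff g c x w y z) x u) := by
        rw [← dirDeriv_mul_add (mdifferentiableAt_torsionCoeff g hc.smooth x z w y)
          (mdifferentiableAt_torsionCoeff g hc.smooth x w y z)]
        congr 1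
        funext p
        exact inner_torsion_lichnerowicz hc hs p _ _ _
      rw [tangentField_self, tangentField_self, tangentField_self] at h
      rw [← h']
      exact eq_sub_of_add_eq h.symm
    intro y z w u
    have hsm : ∀ u : TangentSpace 𝓘(ℝ, E) x, IsSmoothField (tangentField x u) :=
      fun u => isSmoothField_bumpField (E := E) x u
    have h := hKL.bianchi _ _ _ _ (hsm y) (hsm z) (hsm w) (hsm u) x
    simp only [curvature₄] at h
    rw [← add_apply, ← add_apply, ← map_add, ← map_add,
      cyclic_curvature_tangentField hD.smooth, map_add, map_add, add_apply, add_apply,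
      tangentField_self, hmetric, hmetric, hmetric] at h
    exact h

theorem torsionOneForm_eq_zero {g : HermitianMetric E M} {c s : Connection E M}
    (hc : IsChernConnection g c) (hs : IsStromingerConnection g s)
    (hKL : IsKahlerLike g (lichnerowiczConnection c s)) (x : M) (v : TangentSpace 𝓘(ℝ, E) x) :
    torsionOneForm c x v = 0 := by
  have h1 := trace_flip_torsion_eq_zero hc hs hKL x v
  -- The imaginary part of the complex trace is a real trace of J ∘ T(·, v), and this map is T(·,
  -- Jv).
  have h2 := trace_flip_torsion_eq_zero hc hs hKL x (complexStructure x v)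
  have h3 : (torsionMap c x).flip (complexStructure x v) =
      (complexStructure x).toLinearMap ∘ₗ (torsionMap c x).flip v :=
    LinearMap.ext fun u => hc.torsion_type_right x u v
  rw [h3] at h2
  change complexTrace x ((torsionMap c x).flip v) / 2 = 0
  rw [complexTrace, h1, h2]
  simp

end TorsionOneForm

/-! ### Leibniz rule and differentiability for alternating forms. -/

section Calculus

theorem sum_prod_update {V : Type*} {m : ℕ} (b : V → V → ℝ) (A : V → V)
    (w : Fin m × Fin 2 → V) :
    ∑ j, (∏ i ∈ Finset.univ.erase j, b (w (i, 0)) (w (i, 1))) *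
      (b (A (w (j, 0))) (w (j, 1)) + b (w (j, 0)) (A (w (j, 1)))) =
    ∑ p, ∏ j, b (Function.update w p (A (w p)) (j, 0)) (Function.update w p (A (w p)) (j, 1)) := by
  rw [Fintype.sum_prod_type]
  refine Finset.sum_congr rfl fun j _ => ?_
  have h : ∀ c a, ∏ i ∈ Finset.univ.erase j,
      b (Function.update w (j, c) a (i, 0)) (Function.update w (j, c) a (i, 1)) =
      ∏ i ∈ Finset.univ.erase j, b (w (i, 0)) (w (i, 1)) := fun c a =>
    Finset.prod_congr rfl fun i hi => by simp [Finset.ne_of_mem_erase hi]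
  simp only [← Finset.mul_prod_erase Finset.univ _ (Finset.mem_univ j), h, Fin.sum_univ_two]
  simp
  ring

variable {E : Type*} [NormedAddCommGroup E] [NormedSpace ℝ E] [FiniteDimensional ℝ E]

/-- A family of alternating forms is differentiable if its values are. -/
theorem differentiableAt_alternatingMap {F : Type*} [NormedAddCommGroup F] [NormedSpace ℝ F]
    {k : ℕ} {α : F → E [⋀^Fin k]→L[ℝ] ℝ} {y : F}
    (h : ∀ w, DifferentiableAt ℝ (fun z => α z w) y) : DifferentiableAt ℝ α y := by
  -- Evaluation on basis tuples is injective, so a linear left inverse recovers the form from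
  -- finitely many differentiable values.
  let b := Module.finBasis ℝ E
  let ev : (E [⋀^Fin k]→L[ℝ] ℝ) →ₗ[ℝ] (Fin k → Fin (Module.finrank ℝ E)) → ℝ :=
    { toFun := fun f v => f fun i => b (v i)
      map_add' := fun _ _ => rfl
      map_smul' := fun _ _ => rfl }
  have hev : LinearMap.ker ev = ⊥ := by
    refine LinearMap.ker_eq_bot.mpr fun f f' hff => ?_
    exact ContinuousAlternatingMap.toAlternatingMap_injective
      (b.ext_alternating fun v _ => congrFun hff v)
  obtain ⟨r, hr⟩ := ev.exists_leftInverse_of_injective hev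
  have h1 : α = fun z => r.toContinuousLinearMap (ev (α z)) :=
    funext fun z => (LinearMap.congr_fun hr (α z)).symm
  rw [h1]
  exact r.toContinuousLinearMap.differentiableAt.comp y
    (differentiableAt_pi.mpr fun v => h fun i => b (v i))

end Calculus

/-! ### Powers of the Kähler form. -/

section KahlerPower

variable {E : Type*} [NormedAddCommGroup E] [NormedSpace ℂ E]
  {M : Type*} [TopologicalSpace M] [ChartedSpace E M] [IsManifold 𝓘(ℂ, E) ω M]

theorem kahlerPower_apply (g : HermitianMetric E M) (m : ℕ) (x : M)
    (v : Fin (m * 2) → TangentSpace 𝓘(ℝ, E) x) :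
    kahlerPower g m x v = (1 / 2 : ℝ) ^ m * ∑ σ : Equiv.Perm (Fin m × Fin 2),
      ((Equiv.Perm.sign σ : ℤ) : ℝ) * ∏ j : Fin m, kahlerForm g x
        (v (finProdFinEquiv (σ (j, 0)))) (v (finProdFinEquiv (σ (j, 1)))) := by
  change (1 / 2 : ℝ) ^ m • MultilinearMap.alternatization (kahlerTensorPower g m x)
    (fun p => v (finProdFinEquiv p)) = _
  rw [MultilinearMap.alternatization_apply, smul_eq_mul]
  congr 1
  refine Finset.sum_congr rfl fun σ _ => ?_
  rw [Units.smul_def, zsmul_eq_mul]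
  rfl

theorem kahlerForm_complexStructure (g : HermitianMetric E M) (x : M)
    (u v : TangentSpace 𝓘(ℝ, E) x) :
    kahlerForm g x (complexStructure x u) (complexStructure x v) = kahlerForm g x u v :=
  g.invariant x _ _

theorem kahlerPower_complexStructure (g : HermitianMetric E M) (m : ℕ) (x : M)
    (v : Fin (m * 2) → TangentSpace 𝓘(ℝ, E) x) :
    kahlerPower g m x (fun i => complexStructure x (v i)) = kahlerPower g m x v := by
  simp only [kahlerPower_apply, kahlerForm_complexStructure]

/-- A derivation of the Kähler form extends to its powers. -/
theorem kahlerPower_derivation (g : HermitianMetric E M) (m : ℕ) (x : M)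
    (A : TangentSpace 𝓘(ℝ, E) x → TangentSpace 𝓘(ℝ, E) x)
    (v : Fin (m * 2) → TangentSpace 𝓘(ℝ, E) x) :
    (1 / 2 : ℝ) ^ m * ∑ σ : Equiv.Perm (Fin m × Fin 2), ((Equiv.Perm.sign σ : ℤ) : ℝ) *
      ∑ j : Fin m, (∏ i ∈ Finset.univ.erase j, kahlerForm g x
        (v (finProdFinEquiv (σ (i, 0)))) (v (finProdFinEquiv (σ (i, 1))))) *
        (kahlerForm g x (A (v (finProdFinEquiv (σ (j, 0))))) (v (finProdFinEquiv (σ (j, 1)))) +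
          kahlerForm g x (v (finProdFinEquiv (σ (j, 0)))) (A (v (finProdFinEquiv (σ (j, 1)))))) =
    ∑ i, kahlerPower g m x (Function.update v i (A (v i))) := by
  simp only [kahlerPower_apply]
  rw [← Finset.mul_sum, Finset.sum_comm]
  congr 1
  refine Finset.sum_congr rfl fun σ _ => ?_
  rw [← Finset.mul_sum]
  congr 1
  rw [sum_prod_update (kahlerForm g x) A (fun p => v (finProdFinEquiv (σ p)))]
  refine Fintype.sum_equiv (σ.trans finProdFinEquiv) _ _ fun p => ?_
  have h : Function.update (fun p => v (finProdFinEquiv (σ p))) p (A (v (finProdFinEquiv (σ p)))) =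
      fun q => Function.update v (finProdFinEquiv (σ p)) (A (v (finProdFinEquiv (σ p))))
        (finProdFinEquiv (σ q)) := by
    funext q
    by_cases hq : q = p
    · rw [hq, Function.update_self, Function.update_self]
    · rw [Function.update_of_ne hq, Function.update_of_ne (by simpa using hq)]
  simp only [h]
  rfl

end KahlerPower

/-! ### The exterior derivative of Kähler powers and balancedness. -/

section Balanced

open scoped Topology

attribute [local instance] completeSpaceModel

variable {E : Type*} [NormedAddCommGroup E] [NormedSpace ℂ E]
  {M : Type*} [TopologicalSpace M] [ChartedSpace E M] [IsManifold 𝓘(ℂ, E) ω M]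

/-- The coefficients of the Kähler form in the chart at `x`. -/
def chartKahlerForm (g : HermitianMetric E M) (x : M) (u w y : E) : ℝ :=
  kahlerForm g ((extChartAt 𝓘(ℝ, E) x).symm y)
    (mfderiv 𝓘(ℝ, E) 𝓘(ℝ, E) (extChartAt 𝓘(ℝ, E) x).symm y u)
    (mfderiv 𝓘(ℝ, E) 𝓘(ℝ, E) (extChartAt 𝓘(ℝ, E) x).symm y w)

theorem mfderiv_extChartAt_symm_self (x : M) (u : E) :
    mfderiv 𝓘(ℝ, E) 𝓘(ℝ, E) (extChartAt 𝓘(ℝ, E) x).symm (extChartAt 𝓘(ℝ, E) x x) u = u := by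
  rw [← coordField_eq_mfderiv (mem_chart_source E x)]
  exact coordField_self x u

theorem chartKahlerForm_self (g : HermitianMetric E M) (x : M) (u w : E) :
    chartKahlerForm g x u w (extChartAt 𝓘(ℝ, E) x x) = kahlerForm g x u w := by
  have h : chartKahlerForm g x u w (extChartAt 𝓘(ℝ, E) x x) =
      kahlerForm g ((extChartAt 𝓘(ℝ, E) x).symm (extChartAt 𝓘(ℝ, E) x x)) u w := by
    rw [chartKahlerForm]
    congr 1
    · rw [mfderiv_extChartAt_symm_self]
    · exact mfderiv_extChartAt_symm_self x w
  rw [h, extChartAt_to_inv]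

variable [FiniteDimensional ℂ E]

theorem chartKahlerForm_eventuallyEq (g : HermitianMetric E M) (x : M)
    (u w : TangentSpace 𝓘(ℝ, E) x) : chartKahlerForm g x u w =ᶠ[𝓝 (extChartAt 𝓘(ℝ, E) x x)]
    (fun p => g.inner p (tangentField x (complexStructure x u) p) (tangentField x w p)) ∘
      (extChartAt 𝓘(ℝ, E) x).symm := by
  have ht : Filter.Tendsto (extChartAt 𝓘(ℝ, E) x).symm (𝓝 (extChartAt 𝓘(ℝ, E) x x)) (𝓝 x) := by
    have := continuousAt_extChartAt_symm (I := 𝓘(ℝ, E)) x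
    rwa [ContinuousAt, extChartAt_to_inv] at this
  filter_upwards [ht.eventually (bumpField_eventuallyEq (E := E) x u),
    ht.eventually (bumpField_eventuallyEq (E := E) x w), extChartAt_target_mem_nhds x,
    ht.eventually ((chartAt E x).open_source.mem_nhds (mem_chart_source E x))] with y hu hw hy hs
  rw [Function.comp_apply, tangentField_complexStructure]
  have h : ∀ u : E, coordField x u ((extChartAt 𝓘(ℝ, E) x).symm y) =
      mfderiv 𝓘(ℝ, E) 𝓘(ℝ, E) (extChartAt 𝓘(ℝ, E) x).symm y u := by
    intro u
    have h := coordField_eq_mfderiv hs u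
    rw [PartialEquiv.right_inv _ hy] at h
    exact h
  have hu' : tangentField x u ((extChartAt 𝓘(ℝ, E) x).symm y) =
      mfderiv 𝓘(ℝ, E) 𝓘(ℝ, E) (extChartAt 𝓘(ℝ, E) x).symm y u := hu.trans (h u)
  have hw' : tangentField x w ((extChartAt 𝓘(ℝ, E) x).symm y) =
      mfderiv 𝓘(ℝ, E) 𝓘(ℝ, E) (extChartAt 𝓘(ℝ, E) x).symm y w := hw.trans (h w)
  rw [hu', hw']
  rfl

variable [T2Space M]

theorem dirDeriv_kahlerForm {g : HermitianMetric E M} {D : Connection E M}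
    (hD : IsMetric g D) (hDJ : IsComplex D) (x : M) (v u w : TangentSpace 𝓘(ℝ, E) x) :
    dirDeriv (fun p => g.inner p (tangentField x (complexStructure x u) p) (tangentField x w p))
      x v = kahlerForm g x (christoffel D x v u) w + kahlerForm g x u (christoffel D x v w) := by
  rw [dirDeriv_metric_tangentField hD, christoffel_complexStructure hDJ]
  rfl

theorem hasFDerivAt_chartKahlerForm {g : HermitianMetric E M} {D : Connection E M}
    (hD : IsMetric g D) (hDJ : IsComplex D) (x : M) (u w : TangentSpace 𝓘(ℝ, E) x) :
    ∃ L : E →L[ℝ] ℝ, HasFDerivAt (chartKahlerForm g x u w) L (extChartAt 𝓘(ℝ, E) x x) ∧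
      ∀ v, L v = kahlerForm g x (christoffel D x v u) w +
        kahlerForm g x u (christoffel D x v w) := by
  have h := (mdifferentiableAt_metric g (diffAt_tangentField x (complexStructure x u) x)
    (diffAt_tangentField x w x)).hasMFDerivAt
  set L : E →L[ℝ] ℝ := mfderiv 𝓘(ℝ, E) 𝓘(ℝ, ℝ) (fun p => g.inner p
    (tangentField x (complexStructure x u) p) (tangentField x w p)) x
  have h1 : HasFDerivWithinAt ((fun p => g.inner p (tangentField x (complexStructure x u) p)
    (tangentField x w p)) ∘ (extChartAt 𝓘(ℝ, E) x).symm) L (Set.range 𝓘(ℝ, E))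
      (extChartAt 𝓘(ℝ, E) x x) := h.2
  rw [ModelWithCorners.range_eq_univ, hasFDerivWithinAt_univ] at h1
  refine ⟨L, h1.congr_of_eventuallyEq (chartKahlerForm_eventuallyEq g x u w),
    fun v => dirDeriv_kahlerForm hD hDJ x v u w⟩

/-- The Christoffel symbols as a bilinear map. -/
def christoffelMap (D : Connection E M) (x : M) : E →ₗ[ℝ] E →ₗ[ℝ] E :=
  LinearMap.mk₂ ℝ (fun u v => (christoffel D x u v : E))
    (fun u u' v => (D (tangentField x v) x).map_add u u')
    (fun a u v => (D (tangentField x v) x).map_smul a u)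
    (fun u v w => by
      have h : tangentField x (v + w : E) = tangentField x v + tangentField x w :=
        bumpField_add (E := E) x v w
      change D (tangentField x (v + w : E)) x u = _
      rw [h, D.isCovariantDerivativeOnUniv.add (diffAt_tangentField x v x)
        (diffAt_tangentField x w x)]
      rfl)
    (fun a u v => by
      have h : tangentField x (a • v : E) = a • tangentField x v := bumpField_smul (E := E) x a v
      change D (tangentField x (a • v : E)) x u = _
      rw [h, D.isCovariantDerivativeOnUniv.smul_const _ (diffAt_tangentField x v x)]
      rfl)

/-- A power of the Kähler form at `x`, as an alternating form on the model space. -/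
def modelKahlerPower (g : HermitianMetric E M) (m : ℕ) (x : M) : E [⋀^Fin (m * 2)]→ₗ[ℝ] ℝ :=
  (kahlerPower g m x).toAlternatingMap

/-- The pullback of a power of the Kähler form to the chart at `x`. -/
def chartKahlerPower (g : HermitianMetric E M) (m : ℕ) (x : M) (y : E) :
    E [⋀^Fin (m * 2)]→L[ℝ] ℝ :=
  (kahlerPower g m ((extChartAt 𝓘(ℝ, E) x).symm y)).compContinuousLinearMap
    (mfderiv 𝓘(ℝ, E) 𝓘(ℝ, E) (extChartAt 𝓘(ℝ, E) x).symm y)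

omit [FiniteDimensional ℂ E] [T2Space M] in
theorem chartKahlerPower_apply (g : HermitianMetric E M) (m : ℕ) (x : M) (y : E)
    (v : Fin (m * 2) → E) : chartKahlerPower g m x y v =
      (1 / 2 : ℝ) ^ m * ∑ σ : Equiv.Perm (Fin m × Fin 2), ((Equiv.Perm.sign σ : ℤ) : ℝ) *
        ∏ j : Fin m, chartKahlerForm g x (v (finProdFinEquiv (σ (j, 0))))
          (v (finProdFinEquiv (σ (j, 1)))) y :=
  kahlerPower_apply g m _ _

/-- The connection is metric and complex, so ω is parallel: the derivative of its chart coefficients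
at the centre is the Christoffel action, and the Leibniz rule carries this to powers. -/
theorem hasFDerivAt_chartKahlerPower_apply {g : HermitianMetric E M} {D : Connection E M}
    (hD : IsMetric g D) (hDJ : IsComplex D) (m : ℕ) (x : M) (w : Fin (m * 2) → E) :
    ∃ L : E →L[ℝ] ℝ, HasFDerivAt (fun y => chartKahlerPower g m x y w) L
      (extChartAt 𝓘(ℝ, E) x x) ∧
      ∀ v, L v = derivationAction (modelKahlerPower g m x) (christoffelMap D x v) w := by
  choose L hL hLv using fun u w : E => hasFDerivAt_chartKahlerForm hD hDJ x u w
  refine ⟨_, (((HasFDerivAt.fun_sum fun σ _ => (HasFDerivAt.finsetProd fun j _ =>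
    hL (w (finProdFinEquiv (σ (j, 0)))) (w (finProdFinEquiv (σ (j, 1))))).const_mul
      ((Equiv.Perm.sign σ : ℤ) : ℝ)).const_mul ((1 / 2 : ℝ) ^ m)).congr_of_eventuallyEq
    (Filter.Eventually.of_forall fun y => chartKahlerPower_apply g m x y w)), fun v => ?_⟩
  rw [derivationAction_apply]
  refine Eq.trans ?_ (kahlerPower_derivation g m x (fun u => christoffel D x v u) w)
  simp only [smul_apply, sum_apply, smul_eq_mul, hLv, chartKahlerForm_self]

theorem christoffelMap_apply_sub (D : Connection E M) (x : M) (u v : E) :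
    christoffelMap D x u v - christoffelMap D x v u = torsion D x u v :=
  christoffel_sub_christoffel D x u v

theorem extDeriv_chartKahlerPower {g : HermitianMetric E M} {D : Connection E M}
    (hD : IsMetric g D) (hDJ : IsComplex D) (m : ℕ) (x : M) :
    (extDeriv (chartKahlerPower g m x) (extChartAt 𝓘(ℝ, E) x x)).toAlternatingMap =
      christoffelDifferential (christoffelMap D x) (modelKahlerPower g m x) := by
  have hfin : FiniteDimensional ℝ E := FiniteDimensional.complexToReal E
  choose L hL hLv using hasFDerivAt_chartKahlerPower_apply hD hDJ m x
  have hF := (differentiableAt_alternatingMap fun w => (hL w).differentiableAt).hasFDerivAt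
  rw [extDeriv, ContinuousAlternatingMap.toAlternatingMap_alternatizeUncurryFin]
  change _ = AlternatingMap.alternatizeUncurryFin
    (derivationAction (modelKahlerPower g m x) ∘ₗ christoffelMap D x)
  congr 1
  ext v w
  rw [LinearMap.comp_apply, LinearMap.comp_apply, ← hLv]
  have h := ((ContinuousAlternatingMap.apply ℝ E ℝ w).hasFDerivAt.comp _ hF).unique (hL w)
  exact DFunLike.congr_fun h v

theorem isBalanced_of_trace_flip_torsion_eq_zero {g : HermitianMetric E M} {c : Connection E M}
    (hc : IsChernConnection g c)
    (htr : ∀ (x : M) (v : TangentSpace 𝓘(ℝ, E) x),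
      LinearMap.trace ℝ (TangentSpace 𝓘(ℝ, E) x) ((torsionMap c x).flip v) = 0) :
    IsBalanced g := by
  have hfin : FiniteDimensional ℝ E := FiniteDimensional.complexToReal E
  intro x
  rcases Nat.eq_zero_or_pos (Module.finrank ℂ E) with hn | hn
  -- In dimension zero the exponent n − 1 truncates to 0, and the resulting 1-form vanishes on the
  -- zero space.
  · have hE : Subsingleton E := Module.finrank_zero_iff.mp hn
    ext v
    exact ContinuousAlternatingMap.map_coord_zero _ 0 (hE.elim (v 0 : E) 0)
  -- For n ≥ 1 the form ω^{n−1} has real codegree exactly two.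
  · have hk : Module.finrank ℝ E = (Module.finrank ℂ E - 1) * 2 + 2 := by
      rw [finrank_real_of_complex]
      omega
    have h0 : extDeriv (chartKahlerPower g (Module.finrank ℂ E - 1) x)
        (extChartAt 𝓘(ℝ, E) x x) = 0 := by
      refine ContinuousAlternatingMap.toAlternatingMap_injective ?_
      rw [extDeriv_chartKahlerPower hc.metric hc.complex]
      refine christoffelDifferential_eq_zero hk (J := (complexStructure x).toLinearMap)
        (complexStructure_complexStructure x) (fun u v => ?_) (fun u => ?_) ?_
      · rw [christoffelMap_apply_sub, christoffelMap_apply_sub]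
        exact hc.torsion_complexStructure x u v
      · have h : christoffelMap c x u - (christoffelMap c x).flip u =
            -(torsionMap c x).flip u := by
          ext v
          refine (christoffelMap_apply_sub c x u v).trans ?_
          exact torsion_skew c x u v
        have h' : ∀ v : TangentSpace 𝓘(ℝ, E) x, LinearMap.trace ℝ (TangentSpace 𝓘(ℝ, E) x)
            (-(torsionMap c x).flip v) = 0 := fun v => by rw [map_neg, htr, neg_zero]
        rw [h]
        exact h' u
      · ext v
        exact kahlerPower_complexStructure g _ x v
    change ContinuousAlternatingMap.compContinuousLinearMap
      (extDeriv (chartKahlerPower g (Module.finrank ℂ E - 1) x) (extChartAt 𝓘(ℝ, E) x x)) _ = 0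
    rw [h0]
    rfl

end Balanced

end HermitianGeometry

end

theorem mainTheorem3
    {E : Type*} [NormedAddCommGroup E] [NormedSpace ℂ E] [FiniteDimensional ℂ E]
    {M : Type*} [TopologicalSpace M] [T2Space M] [ChartedSpace E M] [IsManifold 𝓘(ℂ, E) ω M]
    (g : HermitianGeometry.HermitianMetric E M)
    (chern strominger : HermitianGeometry.Connection E M)
    (hchern : HermitianGeometry.IsChernConnection g chern)
    (hstrominger : HermitianGeometry.IsStromingerConnection g strominger)
    (hKL : HermitianGeometry.IsKahlerLike g
      (HermitianGeometry.lichnerowiczConnection chern strominger)) :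
    (∀ (x : M) (v : TangentSpace 𝓘(ℝ, E) x),
      HermitianGeometry.torsionOneForm chern x v = 0) ∧
    HermitianGeometry.IsBalanced g :=
  ⟨HermitianGeometry.torsionOneForm_eq_zero hchern hstrominger hKL,
    HermitianGeometry.isBalanced_of_trace_flip_torsion_eq_zero hchern
      (HermitianGeometry.trace_flip_torsion_eq_zero hchern hstrominger hKL)⟩
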